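/- Let $\beta$ be a primitive element of $\mathbb{F}_{2^{10}}$ such that $\alpha:=\beta^{33}$ satisfies $\alpha^5+\alpha^2+1=0$. For $a\in\mathbb F_{2^{10}}$ put $$\begin{aligned}\Phi(a,X,Y)={}&(X^3+a^{24}X^2+a^{4}X+a^{9})Y^3+(a^{17}X^3+a^{29}X^2+X+a^{30})Y^2\\&+(a^{30}X^3+a^{12}X^2+a^{30}X+a^{17})Y+(a^{4}X^3+a^{14}X^2+a^{19}).\end{aligned}$$ Let $F_0=\mathbb{F}_{2^{10}}(u_0)$ be a rational function field, let $F_1=F_0(u_1)$ with $\Phi(\alpha,u_0,u_1)=0$, and for $n\ge 1$ let $F_{n+1}=F_n(u_{n+1})$, where $u_{n+1}$ is a root of the degree two factor of $\Phi(\alpha^{8^{n}},u_n,T)\in F_n[T]$, that is, of the quotient of this polynomial by its degree one factor $$(u_{n-1}+a^{25})T+(a^{28}u_{n-1}+a^{27}),\qquad a=\alpha^{8^{n-1}}.$$ Then for every $n>0$: 1. the number of rational places (places of degree one) of $F_n/\mathbb{F}_{2^{10}}$ is at least $13\cdot 2^{n-1}$; 2. the places $[u_0=\beta^{165}]$ and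 $[u_0=\beta^{891}]$ of $F_0$ split completely in $F_n/F_0$, and if moreover $\beta^{10}+\beta^6+\beta^5+\beta^3+\beta^2+\beta+1=0$, then so do $[u_0=\beta^{368}]$ and $[u_0=\beta^{523}]$; 3. every place of $F_1$ lying above $[u_0=\beta^{858}]$ splits completely in $F_n/F_1$. Here $[u_0=c]$ denotes the zero of $u_0-c$, and a place of $E$ splits completely in a finite extension $E'/E$ if exactly $[E':E]$ places of $E'$ lie above it. -/

import Mathlib

open Polynomial

namespace DrinfeldTower

/-- The polynomial `Φ(a, x, T)` in the variable `T`, over any commutative ring. -/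
noncomputable def Phi {R : Type*} [CommRing R] (a x : R) : R[X] :=
  C (x ^ 3 + a ^ 24 * x ^ 2 + a ^ 4 * x + a ^ 9) * X ^ 3
    + C (a ^ 17 * x ^ 3 + a ^ 29 * x ^ 2 + x + a ^ 30) * X ^ 2
    + C (a ^ 30 * x ^ 3 + a ^ 12 * x ^ 2 + a ^ 30 * x + a ^ 17) * X
    + C (a ^ 4 * x ^ 3 + a ^ 14 * x ^ 2 + a ^ 19)

/-- The factor `(x + a²⁵) T + (a²⁸ x + a²⁷)`, of degree one in `T`, of `Φ(a⁸, y, T)` when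
`Φ(a, x, y) = 0`. -/
noncomputable def linFactor {R : Type*} [CommRing R] (a x : R) : R[X] :=
  C (x + a ^ 25) * X + C (a ^ 28 * x + a ^ 27)

/-- The complementary factor, of degree two in `T`, of `Φ(a⁸, y, T)` when `Φ(a, x, y) = 0`. -/
noncomputable def quadFactor {R : Type*} [Field R] (a x y : R) : R[X] :=
  Phi (a ^ 8) y / linFactor a x

section Tower

variable {K Ω : Type*} [Field K] [Field Ω] [Algebra K Ω]

/-- `u₀, u₁, u₂, …` generate the tower over `K` with parameter `α`: `u₀` is transcendental over
`K`, `u₁` is a root of `Φ(α, u₀, T)`, and `uₙ₊₂` is a root of the factor of degree two of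
`Φ(α ^ 8 ^ (n + 1), uₙ₊₁, T)`. -/
structure IsTowerSeq (α : K) (u : ℕ → Ω) : Prop where
  transcendental : Transcendental K (u 0)
  first : (Phi (algebraMap K Ω α) (u 0)).IsRoot (u 1)
  next : ∀ n : ℕ,
    (quadFactor (algebraMap K Ω α ^ 8 ^ n) (u n) (u (n + 1))).IsRoot (u (n + 2))

variable (K) in
/-- The field `Fₙ = K(u₀, …, uₙ)`. -/
def towerField (u : ℕ → Ω) (n : ℕ) : IntermediateField K Ω :=
  IntermediateField.adjoin K (u '' Set.Iic n)

variable (K) in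
theorem towerField_mono (u : ℕ → Ω) {m n : ℕ} (h : m ≤ n) :
    towerField K u m ≤ towerField K u n :=
  IntermediateField.adjoin.mono K _ _ (Set.image_mono (Set.Iic_subset_Iic.2 h))

variable (K) in
/-- The generator `uᵢ` as an element of `Fₙ`, for `i ≤ n`. -/
def towerGen (u : ℕ → Ω) {i n : ℕ} (h : i ≤ n) : towerField K u n :=
  ⟨u i, IntermediateField.subset_adjoin K _ ⟨i, h, rfl⟩⟩

end Tower

section Places

variable (K : Type*) {F : Type*} [Field K] [Field F] [Algebra K F]

/-- A place of `F / K`, given by its valuation ring: a valuation ring of `F` that contains `K` and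
is not all of `F`. -/
def IsPlace (A : ValuationSubring F) : Prop :=
  (∀ c : K, algebraMap K F c ∈ A) ∧ A ≠ ⊤

/-- A rational place (a place of degree one): every residue class is the class of a constant. -/
def IsRationalPlace (A : ValuationSubring F) : Prop :=
  IsPlace K A ∧ ∀ x ∈ A, ∃ c : K, A.valuation (x - algebraMap K F c) < 1

/-- A place at which the function `x` takes the value `c ∈ K`, that is, a zero of `x - c`. -/
def IsPlaceAt (x : F) (c : K) (A : ValuationSubring F) : Prop :=
  IsPlace K A ∧ A.valuation (x - algebraMap K F c) < 1

end Places

/-- The place `P` of `E` splits completely in `E' / E`: exactly `[E' : E]` places of `E'` lie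
above it. -/
def SplitsCompletely {K Ω : Type*} [Field K] [Field Ω] [Algebra K Ω]
    {E E' : IntermediateField K Ω} (h : E ≤ E') (P : ValuationSubring E) : Prop :=
  {Q : ValuationSubring E' | IsPlace K Q ∧
      Q.comap (IntermediateField.inclusion h : E →+* E') = P}.encard
    = (IntermediateField.relfinrank E E' : ℕ∞)

end DrinfeldTower

/-! Places are followed through the tower by the values of consecutive generators. If `uₙ = x` and
`uₙ₊₁ = y` at a place, the reduction of the quadratic factor at `(x, y)` governs the possible values
of `uₙ₊₂`. Passing to the next level replaces the parameter `a` by `a⁸`, which satisfies the same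
equation, so everything reduces to two finite transition tables over `𝔽₃₂` and `𝔽₄`: `CuspState` and
`SplitState`.

Degrees come from ramification. Above `u₀ = α²⁶` the cubic has a triple root at a smooth point, so
`F₁/F₀` is totally ramified and has degree three (`IsTowerSeq.minpoly_one`). Starting at `u₀ = u₁ =
α²⁸`, the five states of `CuspState` form a cycle of double roots at smooth points, so one valuation
ring `V` of `Ω` has ramification index divisible by `2ⁿ` in `Fₙ` (`IsTowerSeq.exists_cuspData`).
This makes every later step quadratic (`IsTowerSeq.degrees`). The place `V` also shows that the
denominators met in dividing by the linear factor do not vanish.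

Splitting comes from `SplitState.step`: the reduced quadratic has two distinct roots in `K`, and
both lead to states of the table. The exception is `(a²⁷, a²²)`, where the reduction is a square.
There `y - a²²` vanishes to order three in `x - a²⁷`, and the substitution `z = a²³ + (x - a²⁷) w`
turns the quadratic into one reducing to `w² + m w + m²` with `m ≠ 0`, which splits over `𝔽₄`
(`exists_quadratic_substitution`). So the number of exhibited places doubles at each step
(`exists_finset_above`).

At most `[E' : E]` places lie above a place (`card_places_le_finrank`), hence exhibiting that many
proves complete splitting; equality also prevents growth of the residue field
(`isRationalPlace_of_card_eq`). Four values of `u₀` carry three places of `F₁` each, and `α²⁶`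
carries one more, which gives `13 = 4 · 3 + 1`. -/

namespace DrinfeldTower

/-! ### Values of functions at valuation rings containing the constants. -/

section TakesValue

variable {K F L : Type*} [Field K] [Field F] [Algebra K F] [Field L] [Algebra K L]

/-- The function `x` takes the value `c ∈ K` at the valuation ring `A`, which contains `K`. -/
structure TakesValue (A : ValuationSubring F) (x : F) (c : K) : Prop where
  const_mem : ∀ d : K, algebraMap K F d ∈ A
  lt_one : A.valuation (x - algebraMap K F c) < 1

namespace TakesValue

variable {A : ValuationSubring F} {x y : F} {c d : K}

theorem mem (h : TakesValue A x c) : x ∈ A := by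
  have h1 : x - algebraMap K F c ∈ A := A.mem_of_valuation_le_one _ h.lt_one.le
  simpa using A.add_mem _ _ h1 (h.const_mem c)

theorem valuation_le_one (h : TakesValue A x c) : A.valuation x ≤ 1 :=
  (A.valuation_le_one_iff x).2 h.mem

theorem const (hA : ∀ d : K, algebraMap K F d ∈ A) (c : K) :
    TakesValue A (algebraMap K F c) c :=
  ⟨hA, by simp⟩

theorem add (h : TakesValue A x c) (h' : TakesValue A y d) : TakesValue A (x + y) (c + d) := by
  refine ⟨h.const_mem, ?_⟩
  rw [map_add, add_sub_add_comm]
  exact A.valuation.map_add_lt h.lt_one h'.lt_one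

theorem mul (h : TakesValue A x c) (h' : TakesValue A y d) : TakesValue A (x * y) (c * d) := by
  refine ⟨h.const_mem, ?_⟩
  have e : x * y - algebraMap K F (c * d) =
      x * (y - algebraMap K F d) + (x - algebraMap K F c) * algebraMap K F d := by
    rw [map_mul]; ring
  rw [e]
  refine A.valuation.map_add_lt ?_ ?_
  · rw [map_mul]
    rw [mul_comm]
    exact mul_lt_one_of_lt_of_le h'.lt_one h.valuation_le_one
  · rw [map_mul]
    exact mul_lt_one_of_lt_of_le h.lt_one ((A.valuation_le_one_iff _).2 (h.const_mem d))

theorem pow (h : TakesValue A x c) (n : ℕ) : TakesValue A (x ^ n) (c ^ n) := by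
  induction n with
  | zero => simpa using const h.const_mem (1 : K)
  | succ n ih => rw [pow_succ, pow_succ]; exact ih.mul h

theorem valuation_const (hA : ∀ d : K, algebraMap K F d ∈ A) (hc : c ≠ 0) :
    A.valuation (algebraMap K F c) = 1 := by
  have h1 := (A.valuation_le_one_iff _).2 (hA c)
  have h2 := (A.valuation_le_one_iff _).2 (hA c⁻¹)
  refine le_antisymm h1 ?_
  by_contra h
  have h3 := mul_lt_one_of_lt_of_le (not_le.1 h) h2
  rw [← map_mul, ← map_mul, mul_inv_cancel₀ hc] at h3
  simp at h3

theorem valuation_eq_one (h : TakesValue A x c) (hc : c ≠ 0) : A.valuation x = 1 := by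
  have := A.valuation.map_add_eq_of_lt_left
    (h.lt_one.trans_eq (valuation_const h.const_mem hc).symm)
  rw [add_sub_cancel, valuation_const h.const_mem hc] at this
  exact this

theorem ne_zero (h : TakesValue A x c) (hc : c ≠ 0) : x ≠ 0 := by
  rintro rfl
  simpa using h.valuation_eq_one hc

theorem inv (h : TakesValue A x c) (hc : c ≠ 0) : TakesValue A x⁻¹ c⁻¹ := by
  refine ⟨h.const_mem, ?_⟩
  have hx := h.ne_zero hc
  have hc' : algebraMap K F c ≠ 0 := by simpa using hc
  have e : x⁻¹ - algebraMap K F c⁻¹ =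
      (x * algebraMap K F c)⁻¹ * -(x - algebraMap K F c) := by
    rw [map_inv₀]; field_simp; ring
  rw [e, map_mul, map_inv₀, map_mul, h.valuation_eq_one hc, valuation_const h.const_mem hc,
    Valuation.map_neg]
  simpa using h.lt_one

theorem div (h : TakesValue A x c) (h' : TakesValue A y d) (hd : d ≠ 0) :
    TakesValue A (x / y) (c / d) := by
  rw [div_eq_mul_inv, div_eq_mul_inv]
  exact h.mul (h'.inv hd)

theorem neg (h : TakesValue A x c) : TakesValue A (-x) (-c) := by
  refine ⟨h.const_mem, ?_⟩
  rw [map_neg, ← neg_sub', Valuation.map_neg]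
  exact h.lt_one

theorem sub (h : TakesValue A x c) (h' : TakesValue A y d) : TakesValue A (x - y) (c - d) := by
  rw [sub_eq_add_neg, sub_eq_add_neg]
  exact h.add h'.neg

theorem unique (h : TakesValue A x c) (h' : TakesValue A x d) : c = d := by
  by_contra hcd
  have := (h.sub h').valuation_eq_one (sub_ne_zero.2 hcd)
  simp at this

theorem zero_iff (hA : ∀ d : K, algebraMap K F d ∈ A) :
    TakesValue A x (0 : K) ↔ A.valuation x < 1 :=
  ⟨fun h => by simpa using h.lt_one, fun h => ⟨hA, by simpa using h⟩⟩

theorem sub_const_iff : TakesValue A (x - algebraMap K F c) (0 : K) ↔ TakesValue A x c :=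
  ⟨fun h => ⟨h.const_mem, by simpa using h.lt_one⟩, fun h => ⟨h.const_mem, by simpa using h.lt_one⟩⟩

/-- In the trivial valuation ring the nonzero element `x - c` would be a unit, contrary to its
valuation being less than one. -/
theorem isPlace (h : TakesValue A x c) (hx : x ≠ algebraMap K F c) : IsPlace K A := by
  refine ⟨h.const_mem, ?_⟩
  rintro rfl
  have h1 := h.lt_one
  have h2 := ((⊤ : ValuationSubring F).valuation_le_one_iff
    (x - algebraMap K F c)⁻¹).2 (ValuationSubring.mem_top _)
  have h3 := mul_lt_one_of_lt_of_le h1 h2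
  rw [← map_mul, mul_inv_cancel₀ (sub_ne_zero.2 hx)] at h3
  simp at h3

end TakesValue

theorem valuation_comap_lt_one {f : F →+* L} {V : ValuationSubring L} {x : F} :
    (V.comap f).valuation x < 1 ↔ V.valuation (f x) < 1 := by
  rw [← ValuationSubring.mem_nonunits_iff, ← ValuationSubring.mem_nonunits_iff,
    ValuationSubring.mem_nonunits_iff_or, ValuationSubring.mem_nonunits_iff_or,
    ValuationSubring.mem_comap, map_inv₀, map_eq_zero]

theorem takesValue_comap {f : F →ₐ[K] L} {V : ValuationSubring L} {x : F} {c : K} :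
    TakesValue (V.comap (f : F →+* L)) x c ↔ TakesValue V (f x) c := by
  constructor
  · rintro ⟨h1, h2⟩
    refine ⟨fun d => ?_, ?_⟩
    · simpa [ValuationSubring.mem_comap] using h1 d
    · simpa using valuation_comap_lt_one.1 h2
  · rintro ⟨h1, h2⟩
    refine ⟨fun d => ?_, ?_⟩
    · simpa [ValuationSubring.mem_comap] using h1 d
    · refine valuation_comap_lt_one.2 ?_
      simpa using h2

end TakesValue

/-! ### Existence of places with prescribed values, by domination of local data. -/

section Extension

variable {K E L : Type*} [Field K] [Field E] [Field L] [Algebra K E] [Algebra K L] [Algebra E L]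
  [IsScalarTower K E L]

/-- A place extends to any simple extension with a prescribed value of the generator, as long as
that value is a root of the reduction of the minimal polynomial. -/
theorem exists_extension_takesValue (A : ValuationSubring E) (hA : ∀ d : K, algebraMap K E d ∈ A)
    {w : L} (hw : IsIntegral E w) (g : K[X])
    (hg : ∀ i, TakesValue A ((minpoly E w).coeff i) (g.coeff i)) {c : K} (hc : g.eval c = 0) :
    ∃ V : ValuationSubring L, V.comap (algebraMap E L) = A ∧ TakesValue V w c := by
  obtain ⟨f, hf, -, hfm⟩ := lifts_and_natDegree_eq_and_monic (f := A.subtype) (p := minpoly E w)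
    ((lifts_iff_coeff_lifts _).2 fun i => ⟨⟨_, (hg i).mem⟩, rfl⟩) (minpoly.monic hw)
  let κ : K →+* A := (algebraMap K E).codRestrict A.toSubring hA
  let ρ : A →+* IsLocalRing.ResidueField A := IsLocalRing.residue A
  let ψ : A[X] →+* IsLocalRing.ResidueField A := eval₂RingHom ρ (ρ (κ c))
  let φ : A[X] →+* L := eval₂RingHom ((algebraMap E L).comp A.subtype) w
  have hρ : ∀ a : A, ρ a = 0 ↔ A.valuation (a : E) < 1 := fun a => by
    rw [IsLocalRing.residue_eq_zero_iff, ValuationSubring.valuation_lt_one_iff]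
  have hψf : ψ f = 0 := by
    have h1 : f.map ρ = g.map (ρ.comp κ) := by
      ext i
      rw [coeff_map, coeff_map, RingHom.comp_apply, ← sub_eq_zero, ← map_sub, hρ]
      have h2 : ((f.coeff i : A) : E) = (minpoly E w).coeff i := by
        rw [← hf, coeff_map]; rfl
      have h3 := (hg i).lt_one
      rw [← h2] at h3
      exact h3
    change eval₂ ρ (ρ (κ c)) f = 0
    rw [← eval_map, h1, ← RingHom.comp_apply, eval_map, eval₂_at_apply, hc, map_zero]
  -- The kernel of evaluation at `w` is generated by the monic `f`, since divisibility by a monic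
  -- polynomial descends from `E[X]` to `A[X]`. Hence `w ↦ c` is a well-defined map from `A[w]` to
  -- the residue field.
  have hker : ∀ p : A[X], φ p = 0 → ψ p = 0 := by
    intro p hp
    have h1 : aeval w (p.map A.subtype) = 0 := by
      rw [aeval_def, eval₂_map]; exact hp
    have h2 := minpoly.dvd E w h1
    rw [← hf, Polynomial.map_dvd_map _ A.subtype_injective hfm] at h2
    obtain ⟨q, rfl⟩ := h2
    rw [map_mul, hψf, zero_mul]
  let I : Ideal φ.range := (RingHom.ker ψ).map φ.rangeRestrict
  have hI : I ≠ ⊤ := by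
    intro h
    have h1 : (1 : φ.range) ∈ I := h ▸ Submodule.mem_top
    obtain ⟨p, hp, hp1⟩ :=
      (Ideal.mem_map_iff_of_surjective _ φ.rangeRestrict_surjective).1 h1
    have h2 : φ (p - 1) = 0 := by
      have := congrArg Subtype.val hp1
      rw [map_sub, map_one, sub_eq_zero]
      simpa using this
    have h3 := hker _ h2
    rw [map_sub, map_one, (RingHom.mem_ker).1 hp] at h3
    simp at h3
  -- Chevalley's theorem: some valuation ring contains `A[w]` and has the proper ideal `I` among its
  -- nonunits.
  obtain ⟨V, hV, hVI⟩ := Ideal.image_subset_nonunits_valuationSubring I hI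
  have hVI' : ∀ p : A[X], ψ p = 0 → V.valuation (φ p) < 1 := by
    intro p hp
    exact hVI ⟨φ.rangeRestrict p, Ideal.mem_map_of_mem _ hp, rfl⟩
  have hAV : ∀ x ∈ A, algebraMap E L x ∈ V := fun x hx =>
    hV ⟨C ⟨x, hx⟩, by simp [φ]⟩
  have hmV : ∀ x, A.valuation x < 1 → V.valuation (algebraMap E L x) < 1 := by
    intro x hx
    have hxA := A.mem_of_valuation_le_one _ hx.le
    have := hVI' (C ⟨x, hxA⟩) (by simpa [ψ] using (hρ ⟨x, hxA⟩).2 hx)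
    simpa [φ] using this
  refine ⟨V, ?_, fun d => ?_, ?_⟩
  · ext x
    rw [ValuationSubring.mem_comap]
    refine ⟨fun hx => ?_, hAV x⟩
    -- Outside `A`, the inverse `x⁻¹` lies in the maximal ideal of `A`, hence in that of `V`, so `x`
    -- cannot lie in `V`.
    by_contra hxA
    have h1 : x⁻¹ ∈ A.nonunits := A.inv_mem_nonunits_iff.2 (Or.inr hxA)
    have h2 := hmV _ h1
    rw [map_inv₀] at h2
    rcases V.inv_mem_nonunits_iff.1 h2 with h3 | h3
    · rw [map_eq_zero] at h3
      exact hxA (h3 ▸ A.zero_mem)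
    · exact h3 hx
  · rw [IsScalarTower.algebraMap_apply K E L]
    exact hAV _ (hA d)
  · have := hVI' (X - C (κ c)) (by simp [ψ])
    have e : φ (X - C (κ c)) = w - algebraMap K L c := by
      rw [IsScalarTower.algebraMap_apply K E L]
      simp [φ, κ]
    rwa [e] at this

/-- A transcendental function takes any given value at some valuation ring. -/
theorem exists_takesValue_of_transcendental {t : L} (ht : Transcendental K t) (c : K) :
    ∃ V : ValuationSubring L, TakesValue V t c := by
  let φ : K[X] →+* L := (aeval t : K[X] →ₐ[K] L)
  have hφ : Function.Injective φ := transcendental_iff_injective.1 ht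
  let I : Ideal φ.range := (Ideal.span {X - C c}).map φ.rangeRestrict
  have hI : I ≠ ⊤ := by
    intro h
    have h1 : (1 : φ.range) ∈ I := h ▸ Submodule.mem_top
    obtain ⟨p, hp, hp1⟩ :=
      (Ideal.mem_map_iff_of_surjective _ φ.rangeRestrict_surjective).1 h1
    have h2 : p = 1 := hφ (by simpa using congrArg Subtype.val hp1)
    rw [h2, Ideal.mem_span_singleton, dvd_iff_isRoot] at hp
    simp at hp
  obtain ⟨V, hV, hVI⟩ := Ideal.image_subset_nonunits_valuationSubring I hI
  refine ⟨V, fun d => hV ⟨C d, by simp [φ]⟩, ?_⟩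
  have : φ (X - C c) ∈ V.nonunits :=
    hVI ⟨φ.rangeRestrict (X - C c), Ideal.mem_map_of_mem _ (Ideal.mem_span_singleton_self _), rfl⟩
  simpa [φ, ValuationSubring.mem_nonunits_iff] using this

end Extension

/-! ### Places above a given place: the bound by the degree, and residue fields in the case of
equality. -/

section PlacesAbove

variable {E L : Type*} [Field E] [Field L] [Algebra E L]

/-- After division by a coefficient of maximal valuation, chosen as the last such one, a nonzero
polynomial has integral coefficients, one of them `1`, with all later ones in the maximal ideal. -/
theorem exists_normalized_last (A : ValuationSubring E) {p : E[X]} (hp : p ≠ 0) :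
    ∃ (s : E) (k : ℕ), s ≠ 0 ∧ s * p.coeff k = 1 ∧ (∀ j, s * p.coeff j ∈ A) ∧
      ∀ j, k < j → A.valuation (s * p.coeff j) < 1 := by
  classical
  obtain ⟨m, hm, hmax⟩ := p.support.exists_max_image (fun i => A.valuation (p.coeff i))
    (Polynomial.support_nonempty.2 hp)
  let T := p.support.filter fun i => A.valuation (p.coeff i) = A.valuation (p.coeff m)
  have hT : T.Nonempty := ⟨m, by simpa [T] using hm⟩
  let k := T.max' hT
  have hk : k ∈ T := T.max'_mem hT
  obtain ⟨hk1, hk2⟩ := Finset.mem_filter.1 hk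
  have hk0 : p.coeff k ≠ 0 := mem_support_iff.1 hk1
  have hle : ∀ j, A.valuation (p.coeff j) ≤ A.valuation (p.coeff k) := by
    intro j
    by_cases hj : p.coeff j = 0
    · simp [hj]
    · exact (hmax j (mem_support_iff.2 hj)).trans_eq hk2.symm
  have hv0 : A.valuation (p.coeff k) ≠ 0 := by simpa using hk0
  refine ⟨(p.coeff k)⁻¹, k, inv_ne_zero hk0, inv_mul_cancel₀ hk0, fun j => ?_, fun j hj => ?_⟩
  · rw [← A.valuation_le_one_iff, map_mul, map_inv₀, inv_mul_le_one₀ (zero_lt_iff.2 hv0)]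
    exact hle j
  · rw [map_mul, map_inv₀, inv_mul_lt_one₀ (zero_lt_iff.2 hv0)]
    refine lt_of_le_of_ne (hle j) fun h => ?_
    have hj0 : p.coeff j ≠ 0 := fun h0 => hv0 (by rw [← h, h0, map_zero])
    have : j ∈ T := Finset.mem_filter.2 ⟨mem_support_iff.2 hj0, h.trans hk2⟩
    exact absurd (T.le_max' j this) (not_le.2 hj)

/-- The same, with the first coefficient of maximal valuation. -/
theorem exists_normalized_first (A : ValuationSubring E) {p : E[X]} (hp : p ≠ 0) :
    ∃ (s : E) (k : ℕ), s ≠ 0 ∧ s * p.coeff k = 1 ∧ (∀ j, s * p.coeff j ∈ A) ∧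
      ∀ j, j < k → A.valuation (s * p.coeff j) < 1 := by
  classical
  obtain ⟨s, k, hs, h1, h2, -⟩ := exists_normalized_last A hp
  have hex : ∃ k, A.valuation (s * p.coeff k) = 1 := ⟨k, by rw [h1, map_one]⟩
  let m := Nat.find hex
  have hm : A.valuation (s * p.coeff m) = 1 := Nat.find_spec hex
  have hm0 : s * p.coeff m ≠ 0 := fun h => by simp [h] at hm
  refine ⟨(s * p.coeff m)⁻¹ * s, m, mul_ne_zero (inv_ne_zero hm0) hs, ?_, fun j => ?_,
    fun j hj => ?_⟩
  · rw [mul_assoc, inv_mul_cancel₀ hm0]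
  · rw [← A.valuation_le_one_iff, mul_assoc, map_mul, map_inv₀, hm, inv_one, one_mul,
      A.valuation_le_one_iff]
    exact h2 j
  · rw [mul_assoc, map_mul, map_inv₀, hm, inv_one, one_mul]
    exact lt_of_le_of_ne ((A.valuation_le_one_iff _).2 (h2 j)) (Nat.find_min hex hj)

theorem algebraMap_mem_of_comap_eq {A : ValuationSubring E} {Q : ValuationSubring L}
    (hQ : Q.comap (algebraMap E L) = A) {a : E} (ha : a ∈ A) : algebraMap E L a ∈ Q := by
  rw [← hQ] at ha; exact ha

theorem valuation_algebraMap_lt_one {A : ValuationSubring E} {Q : ValuationSubring L}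
    (hQ : Q.comap (algebraMap E L) = A) {a : E} (ha : A.valuation a < 1) :
    Q.valuation (algebraMap E L a) < 1 := by
  subst hQ
  exact valuation_comap_lt_one.1 ha

theorem sum_mem_valuationSubring {ι : Type*} (Q : ValuationSubring L) (s : Finset ι) (f : ι → L)
    (h : ∀ i ∈ s, f i ∈ Q) : ∑ i ∈ s, f i ∈ Q :=
  Q.toSubring.sum_mem h

theorem valuation_sum_lt_one {ι : Type*} (Q : ValuationSubring L) (s : Finset ι) (f : ι → L)
    (h : ∀ i ∈ s, Q.valuation (f i) < 1) : Q.valuation (∑ i ∈ s, f i) < 1 :=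
  Q.valuation.map_sum_lt one_ne_zero h

/-- Elements of `L` that lie in every valuation ring of `L` containing `A`. -/
def IsIntegralOver (A : ValuationSubring E) (y : L) : Prop :=
  ∀ W : ValuationSubring L, (∀ a ∈ A, algebraMap E L a ∈ W) → y ∈ W

theorem IsIntegralOver.mem {A : ValuationSubring E} {y : L} (hy : IsIntegralOver A y)
    {Q : ValuationSubring L} (hQ : Q.comap (algebraMap E L) = A) : y ∈ Q :=
  hy Q fun _ ha => algebraMap_mem_of_comap_eq hQ ha

/-- Every algebraic element `x` is a quotient of integral elements whose denominator is a unit at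
all places above `A` where `x` is integral. -/
theorem exists_integral_fraction (A : ValuationSubring E) {x : L} (hx : IsAlgebraic E x) :
    ∃ y : L, IsIntegralOver A y ∧ IsIntegralOver A (y * x) ∧
      ∀ Q : ValuationSubring L, Q.comap (algebraMap E L) = A → x ∈ Q → Q.valuation y = 1 := by
  by_cases hx0 : x = 0
  · subst hx0
    exact ⟨1, fun W _ => W.one_mem, fun W _ => by simp, fun Q _ _ => map_one _⟩
  obtain ⟨p, hp, hpx⟩ := hx
  obtain ⟨s, k, -, hk, hA, hlt⟩ := exists_normalized_last A hp
  set b : ℕ → L := fun j => algebraMap E L (s * p.coeff j) with hb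
  set M := p.natDegree + 1
  -- The relation for `x` is cut at the last dominant index: `z + xᵏ y = 0`. If `x ∈ W`, the formula
  -- for `y` shows `y, y x ∈ W`. If `x⁻¹ ∈ W`, the relation writes `y x` as a polynomial in `x⁻¹`.
  -- Where `x` is integral above `A`, `y` is `1` plus an element of the maximal ideal.
  set y := ∑ j ∈ Finset.range M, b (k + j) * x ^ j with hy
  set z := ∑ j ∈ Finset.range k, b j * x ^ j with hz
  have hrel : z + x ^ k * y = 0 := by
    have h1 : ∑ j ∈ Finset.range (k + M), b j * x ^ j = 0 := by
      have h2 : algebraMap E L s * aeval x p = 0 := by rw [hpx, mul_zero]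
      rw [aeval_eq_sum_range' (n := k + M) (by omega), Finset.mul_sum] at h2
      rw [← h2]
      refine Finset.sum_congr rfl fun j _ => ?_
      rw [hb, Algebra.smul_def]; simp only [map_mul]; ring
    rw [Finset.sum_range_add] at h1
    rw [← h1, hy, Finset.mul_sum]
    congr 1
    exact Finset.sum_congr rfl fun j _ => by ring
  have hbW : ∀ W : ValuationSubring L, (∀ a ∈ A, algebraMap E L a ∈ W) → ∀ j, b j ∈ W :=
    fun W hW j => hW _ (hA j)
  have key : ∀ W : ValuationSubring L, (∀ a ∈ A, algebraMap E L a ∈ W) → y ∈ W ∧ y * x ∈ W := by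
    intro W hW
    rcases W.mem_or_inv_mem x with h | h
    · have hyW : y ∈ W := sum_mem_valuationSubring _ _ _ fun j _ =>
        W.mul_mem _ _ (hbW W hW _) (pow_mem h j)
      exact ⟨hyW, W.mul_mem _ _ hyW h⟩
    · have hyx : y * x = -∑ j ∈ Finset.range k, b j * x⁻¹ ^ (k - 1 - j) := by
        have hxk : x ^ k ≠ 0 := pow_ne_zero _ hx0
        apply mul_left_cancel₀ hxk
        have : x ^ k * (y * x) = -(z * x) := by linear_combination x * hrel
        rw [this, hz, Finset.sum_mul, mul_neg, Finset.mul_sum]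
        congr 1
        refine Finset.sum_congr rfl fun j hj => ?_
        have hjk := Finset.mem_range.1 hj
        have e : x ^ k = x ^ j * x * x ^ (k - 1 - j) := by
          rw [← pow_succ, ← pow_add]; congr 1; omega
        rw [e, inv_pow]
        field_simp
      have hyxW : y * x ∈ W := by
        rw [hyx]
        exact W.neg_mem _ (sum_mem_valuationSubring _ _ _ fun j _ =>
          W.mul_mem _ _ (hbW W hW _) (pow_mem h _))
      refine ⟨?_, hyxW⟩
      have : y = y * x * x⁻¹ := by field_simp
      rw [this]
      exact W.mul_mem _ _ hyxW h
  refine ⟨y, fun W hW => (key W hW).1, fun W hW => (key W hW).2, fun Q hQ hxQ => ?_⟩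
  have h1 : y = (∑ j ∈ Finset.range p.natDegree, b (k + (j + 1)) * x ^ (j + 1)) + 1 := by
    have hbk : b k = 1 := by rw [hb]; simp only [hk, map_one]
    rw [hy, Finset.sum_range_succ', add_zero, hbk, pow_zero, mul_one]
  rw [h1]
  have h2 : Q.valuation (∑ j ∈ Finset.range p.natDegree, b (k + (j + 1)) * x ^ (j + 1)) < 1 := by
    refine valuation_sum_lt_one _ _ _ fun j _ => ?_
    rw [map_mul]
    exact mul_lt_one_of_lt_of_le (valuation_algebraMap_lt_one hQ (hlt _ (by omega)))
      ((Q.valuation_le_one_iff _).2 (pow_mem hxQ _))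
  rw [Valuation.map_add_eq_of_lt_right _ (by rwa [map_one]), map_one]

/-- There are no proper inclusions between valuation rings above `A` in an algebraic extension. -/
theorem eq_of_le_of_comap_eq [Algebra.IsAlgebraic E L] {A : ValuationSubring E}
    {Q R : ValuationSubring L} (hQ : Q.comap (algebraMap E L) = A)
    (hR : R.comap (algebraMap E L) = A) (h : Q ≤ R) : Q = R := by
  refine le_antisymm h fun x hxR => ?_
  by_contra hxQ
  have hx0 : x ≠ 0 := fun h0 => hxQ (h0 ▸ Q.zero_mem)
  set t := x⁻¹ with ht
  have ht0 : t ≠ 0 := inv_ne_zero hx0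
  have htQ : Q.valuation t < 1 := Q.inv_mem_nonunits_iff.2 (Or.inr hxQ)
  have htR1 : R.valuation t = 1 := by
    have h1 : t ∈ R := h (Q.mem_of_valuation_le_one _ htQ.le)
    refine le_antisymm ((R.valuation_le_one_iff _).2 h1) ?_
    have h2 := (R.valuation_le_one_iff _).2 hxR
    rw [ht, map_inv₀]
    exact (one_le_inv₀ (zero_lt_iff.2 (by simpa using hx0))).2 h2
  have htR := R.mem_of_valuation_le_one t htR1.le
  obtain ⟨p, hp, hpx⟩ := Algebra.IsAlgebraic.isAlgebraic (R := E) t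
  -- Here `t` is a unit of `R` and a nonunit of `Q`. Cutting the relation at the first dominant
  -- index makes the lower part small at `R`, so `t y + 1` is a nonunit of `R`, and then of `Q`; but
  -- `t y` is itself a nonunit of `Q`.
  obtain ⟨s, k, -, hk, hA, hlt⟩ := exists_normalized_first A hp
  set b : ℕ → L := fun j => algebraMap E L (s * p.coeff j) with hb
  set S := ∑ j ∈ Finset.range k, b j * t ^ j with hS
  set y := ∑ j ∈ Finset.range p.natDegree, b (k + (j + 1)) * t ^ j with hy
  have hrel : S + t ^ k * (t * y + 1) = 0 := by
    have h1 : ∑ j ∈ Finset.range (k + (p.natDegree + 1)), b j * t ^ j = 0 := by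
      have h2 : algebraMap E L s * aeval t p = 0 := by rw [hpx, mul_zero]
      rw [aeval_eq_sum_range' (n := k + (p.natDegree + 1)) (by omega), Finset.mul_sum] at h2
      rw [← h2]
      refine Finset.sum_congr rfl fun j _ => ?_
      rw [hb, Algebra.smul_def]; simp only [map_mul]; ring
    rw [Finset.sum_range_add, Finset.sum_range_succ'] at h1
    rw [← h1, hy, mul_add, Finset.mul_sum, Finset.mul_sum]
    congr 2
    · exact Finset.sum_congr rfl fun j _ => by ring
    · have hbk : b k = 1 := by rw [hb]; simp only [hk, map_one]
      rw [add_zero, hbk, mul_one, one_mul]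
  have hyQ : y ∈ Q := sum_mem_valuationSubring _ _ _ fun j _ =>
    Q.mul_mem _ _ (algebraMap_mem_of_comap_eq hQ (hA _))
      (pow_mem (Q.mem_of_valuation_le_one _ htQ.le) _)
  have hSR : R.valuation S < 1 := valuation_sum_lt_one _ _ _ fun j hj => by
    rw [map_mul]
    exact mul_lt_one_of_lt_of_le
      (valuation_algebraMap_lt_one hR (hlt _ (Finset.mem_range.1 hj)))
      ((R.valuation_le_one_iff _).2 (pow_mem htR _))
  have h1 : R.valuation (t * y + 1) < 1 := by
    have h2 : R.valuation (t ^ k * (t * y + 1)) < 1 := by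
      rw [← neg_eq_of_add_eq_zero_right hrel, Valuation.map_neg]; exact hSR
    rwa [map_mul, map_pow, htR1, one_pow, one_mul] at h2
  have h2 : Q.valuation (t * y + 1) < 1 := ValuationSubring.nonunits_le_nonunits.2 h h1
  have h3 : Q.valuation (t * y) < 1 := by
    rw [map_mul]
    exact mul_lt_one_of_lt_of_le htQ ((Q.valuation_le_one_iff _).2 hyQ)
  rw [Valuation.map_add_eq_of_lt_right _ (by rwa [map_one]), map_one] at h2
  exact lt_irrefl _ h2

/-- Otherwise every integral element that is a unit at `Q` would be a unit at `R`. Writing `x ∈ Q`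
as `(y x) / y` with integral numerator and denominator would give `Q ≤ R`, and inclusions between
places above `A` are equalities. -/
theorem exists_integral_separating [Algebra.IsAlgebraic E L] {A : ValuationSubring E}
    {Q R : ValuationSubring L} (hQ : Q.comap (algebraMap E L) = A)
    (hR : R.comap (algebraMap E L) = A) (h : Q ≠ R) :
    ∃ c : L, IsIntegralOver A c ∧ Q.valuation c = 1 ∧ R.valuation c < 1 := by
  by_contra! H
  refine h (eq_of_le_of_comap_eq hQ hR fun x hx => ?_)
  obtain ⟨y, hy, hyx, hu⟩ := exists_integral_fraction A (Algebra.IsAlgebraic.isAlgebraic (R := E) x)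
  have h1 : 1 ≤ R.valuation y := H y hy (hu Q hQ hx)
  have h2 : R.valuation (y * x) ≤ 1 := (R.valuation_le_one_iff _).2 (hyx.mem hR)
  rw [← R.valuation_le_one_iff]
  rw [map_mul] at h2
  by_contra h3
  have : (1 : R.ValueGroup) < R.valuation y * R.valuation x :=
    one_lt_mul_of_le_of_lt h1 (not_le.1 h3)
  exact absurd h2 (not_le.2 this)

/-- For finitely many places above `A` there are integral elements that are units at exactly one of
them. -/
theorem exists_dual_family [Algebra.IsAlgebraic E L] {A : ValuationSubring E}
    (s : Finset (ValuationSubring L)) (hs : ∀ Q ∈ s, Q.comap (algebraMap E L) = A) :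
    ∃ e : ValuationSubring L → L, ∀ Q ∈ s, IsIntegralOver A (e Q) ∧ Q.valuation (e Q) = 1 ∧
      ∀ R ∈ s, R ≠ Q → R.valuation (e Q) < 1 := by
  classical
  have H : ∀ Q R : ValuationSubring L, ∃ c : L, Q ∈ s → R ∈ s → Q ≠ R →
      IsIntegralOver A c ∧ Q.valuation c = 1 ∧ R.valuation c < 1 := by
    intro Q R
    by_cases h : Q ∈ s ∧ R ∈ s ∧ Q ≠ R
    · obtain ⟨c, hc⟩ := exists_integral_separating (hs Q h.1) (hs R h.2.1) h.2.2
      exact ⟨c, fun _ _ _ => hc⟩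
    · exact ⟨0, fun h1 h2 h3 => absurd ⟨h1, h2, h3⟩ h⟩
  choose c hc using H
  have hint : ∀ Q ∈ s, ∀ t : Finset (ValuationSubring L), t ⊆ s.erase Q →
      IsIntegralOver A (∏ R ∈ t, c Q R) := by
    intro Q hQ t ht W hW
    refine W.toSubring.prod_mem fun R hR => ?_
    have hR := Finset.mem_erase.1 (ht hR)
    exact (hc Q R hQ hR.2 hR.1.symm).1 W hW
  refine ⟨fun Q => ∏ R ∈ s.erase Q, c Q R, fun Q hQ => ⟨hint Q hQ _ (Finset.Subset.refl _), ?_, ?_⟩⟩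
  · rw [map_prod]
    refine Finset.prod_eq_one fun R hR => ?_
    have hR := Finset.mem_erase.1 hR
    exact (hc Q R hQ hR.2 hR.1.symm).2.1
  · intro R hR hRQ
    have hR' : R ∈ s.erase Q := Finset.mem_erase.2 ⟨hRQ, hR⟩
    beta_reduce
    rw [← Finset.mul_prod_erase _ _ hR', map_mul]
    exact mul_lt_one_of_lt_of_le (hc Q R hQ hR hRQ.symm).2.2
      ((R.valuation_le_one_iff _).2
        ((hint Q hQ _ (Finset.erase_subset _ _)).mem (hs R hR)))

/-- Nonzero families of scalars can be rescaled to be integral with one member equal to `1`. -/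
theorem exists_normalized_family (A : ValuationSubring E) {ι : Type*} [Fintype ι] {a : ι → E}
    (ha : ∃ i, a i ≠ 0) : ∃ (r : E) (k : ι), r * a k = 1 ∧ ∀ j, r * a j ∈ A := by
  obtain ⟨i, hi⟩ := ha
  obtain ⟨k, -, hk⟩ := Finset.univ.exists_max_image (fun i => A.valuation (a i))
    ⟨i, Finset.mem_univ i⟩
  have hv0 : A.valuation (a k) ≠ 0 := by
    intro h
    have := hk i (Finset.mem_univ i)
    rw [h, le_zero_iff, map_eq_zero] at this
    exact hi this
  have hk0 : a k ≠ 0 := by simpa using hv0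
  refine ⟨(a k)⁻¹, k, inv_mul_cancel₀ hk0, fun j => ?_⟩
  rw [← A.valuation_le_one_iff, map_mul, map_inv₀, inv_mul_le_one₀ (zero_lt_iff.2 hv0)]
  exact hk j (Finset.mem_univ j)

/-- At most `[L : E]` places lie above a place of `E`. -/
theorem card_places_le_finrank [FiniteDimensional E L] {A : ValuationSubring E}
    (s : Finset (ValuationSubring L)) (hs : ∀ Q ∈ s, Q.comap (algebraMap E L) = A) :
    s.card ≤ Module.finrank E L := by
  classical
  obtain ⟨e, he⟩ := exists_dual_family s hs
  -- Rescale a relation so that its coefficients are integral and the one at `k` is `1`. At the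
  -- place `k` that term is a unit and all others lie in the maximal ideal.
  have hli : LinearIndependent E (fun Q : s => e Q) := by
    rw [Fintype.linearIndependent_iff]
    intro g hg
    by_contra! H
    obtain ⟨r, k, hk, hr⟩ := exists_normalized_family A H
    have h1 : ∑ Q : s, algebraMap E L (r * g Q) * e Q = 0 := by
      have h2 : algebraMap E L r * ∑ Q : s, g Q • e Q = 0 := by rw [hg, mul_zero]
      rw [Finset.mul_sum] at h2
      rw [← h2]
      exact Finset.sum_congr rfl fun Q _ => by rw [Algebra.smul_def, map_mul]; ring
    rw [← Finset.add_sum_erase _ _ (Finset.mem_univ k), hk, map_one, one_mul] at h1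
    have h3 : k.1.valuation (∑ Q ∈ Finset.univ.erase k, algebraMap E L (r * g Q) * e Q) < 1 := by
      refine valuation_sum_lt_one _ _ _ fun Q hQ => ?_
      have hne : k.1 ≠ Q.1 := fun h => (Finset.mem_erase.1 hQ).1 (Subtype.ext h.symm)
      rw [map_mul, mul_comm]
      exact mul_lt_one_of_lt_of_le ((he Q Q.2).2.2 k k.2 hne)
        ((ValuationSubring.valuation_le_one_iff _ _).2
          (algebraMap_mem_of_comap_eq (hs k k.2) (hr Q)))
    rw [← neg_eq_of_add_eq_zero_right h1, Valuation.map_neg, (he k k.2).2.1] at h3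
    exact lt_irrefl _ h3
  simpa using hli.fintype_card_le_finrank

/-- If the number of places above `A` is the degree of the extension, then the residue fields do not
grow. -/
theorem exists_residue_eq_of_card_eq [FiniteDimensional E L] {A : ValuationSubring E}
    (s : Finset (ValuationSubring L)) (hs : ∀ Q ∈ s, Q.comap (algebraMap E L) = A)
    (hcard : s.card = Module.finrank E L) {Q : ValuationSubring L} (hQ : Q ∈ s) {x : L}
    (hx : IsIntegralOver A x) : ∃ a ∈ A, Q.valuation (x - algebraMap E L a) < 1 := by
  classical
  obtain ⟨e, he⟩ := exists_dual_family s hs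
  -- One element too many for the degree, hence a nontrivial relation. At `Q` all terms except those
  -- of `x * e Q` and `e Q` are small, so the relation determines the residue of `x` once the
  -- coefficient of `x * e Q` is known to be a unit.
  let f : Option s → L := fun o => o.elim (x * e Q) fun R => e R
  have hnli : ¬ LinearIndependent E f := by
    intro h
    have := h.fintype_card_le_finrank
    simp [hcard] at this
  rw [Fintype.linearIndependent_iff] at hnli
  push Not at hnli
  obtain ⟨g, hg, H⟩ := hnli
  obtain ⟨r, k, hk, hr⟩ := exists_normalized_family A H
  have h1 : ∑ o, algebraMap E L (r * g o) * f o = 0 := by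
    have h2 : algebraMap E L r * ∑ o, g o • f o = 0 := by rw [hg, mul_zero]
    rw [Finset.mul_sum] at h2
    rw [← h2]
    exact Finset.sum_congr rfl fun Q _ => by rw [Algebra.smul_def, map_mul]; ring
  set b : Option s → E := fun o => r * g o with hb
  have hint : ∀ R : s, ∀ o, R.1.valuation (algebraMap E L (b o)) ≤ 1 := fun R o =>
    (ValuationSubring.valuation_le_one_iff _ _).2 (algebraMap_mem_of_comap_eq (hs R R.2) (hr o))
  rw [Fintype.sum_option] at h1
  have hoff : ∀ R : s, R.1.valuation (∑ R' ∈ Finset.univ.erase R,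
      algebraMap E L (b (some R')) * f (some R')) < 1 := by
    intro R
    refine valuation_sum_lt_one _ _ _ fun R' hR' => ?_
    have hne : R.1 ≠ R'.1 := fun h => (Finset.mem_erase.1 hR').1 (Subtype.ext h.symm)
    rw [map_mul, mul_comm]
    exact mul_lt_one_of_lt_of_le ((he R' R'.2).2.2 R R.2 hne) (hint _ _)
  let Q' : s := ⟨Q, hQ⟩
  have hQv : Q.valuation (algebraMap E L (b none) * x + algebraMap E L (b (some Q'))) < 1 := by
    have h2 := hoff Q'
    rw [← Finset.add_sum_erase _ _ (Finset.mem_univ Q')] at h1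
    have h3 : ∑ R' ∈ Finset.univ.erase Q', algebraMap E L (b (some R')) * f (some R') =
        -((algebraMap E L (b none) * x + algebraMap E L (b (some Q'))) * e Q) := by
      have hf1 : f none = x * e Q := rfl
      have hf2 : f (some Q') = e Q := rfl
      rw [hf1, hf2] at h1
      linear_combination h1
    rw [h3, Valuation.map_neg, map_mul] at h2
    have h4 : Q.valuation (e Q) = 1 := (he Q hQ).2.1
    change Q.valuation _ * Q.valuation (e Q) < 1 at h2
    rwa [h4, mul_one] at h2
  -- If this coefficient were a nonunit, some other coefficient would be `1`, say at `R`. At `R` the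
  -- term `e R` would then be a unit cancelled by nonunits.
  have hnone : Q.valuation (algebraMap E L (b none)) = 1 := by
    by_contra hne
    have hlt : Q.valuation (algebraMap E L (b none)) < 1 := lt_of_le_of_ne (hint Q' none) hne
    have hltA : A.valuation (b none) < 1 := by
      have := hs Q hQ
      subst this
      exact valuation_comap_lt_one.2 hlt
    cases k with
    | none =>
      have : b none = 1 := hk
      rw [this] at hlt
      simp at hlt
    | some R =>
      by_cases hRQ : R = Q'
      · subst hRQ
        have hb1 : b (some Q') = 1 := hk
        rw [hb1, map_one] at hQv
        have h5 : Q.valuation (algebraMap E L (b none) * x) < 1 := by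
          rw [map_mul]
          exact mul_lt_one_of_lt_of_le hlt ((Q.valuation_le_one_iff _).2 (hx.mem (hs Q hQ)))
        rw [Valuation.map_add_eq_of_lt_right _ (by rwa [map_one]), map_one] at hQv
        exact lt_irrefl _ hQv
      · have hb1 : b (some R) = 1 := hk
        rw [← Finset.add_sum_erase _ _ (Finset.mem_univ R)] at h1
        change _ + (algebraMap E L (b (some R)) * _ + _) = 0 at h1
        rw [hb1, map_one, one_mul] at h1
        have h5 : R.1.valuation (algebraMap E L (b none) * f none) < 1 := by
          rw [map_mul]
          refine mul_lt_one_of_lt_of_le (valuation_algebraMap_lt_one (hs R R.2) hltA) ?_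
          rw [ValuationSubring.valuation_le_one_iff]
          exact R.1.mul_mem _ _ (hx.mem (hs R R.2)) ((he Q hQ).1.mem (hs R R.2))
        have h6 := R.1.valuation.map_add_lt h5 (hoff R)
        have h7 : f (some R) = -(algebraMap E L (b none) * f none +
            ∑ R' ∈ Finset.univ.erase R, algebraMap E L (b (some R')) * f (some R')) := by
          linear_combination h1
        have h8 : R.1.valuation (f (some R)) = 1 := (he R R.2).2.1
        rw [h7, Valuation.map_neg] at h8
        exact h6.ne h8
  have hb0 : algebraMap E L (b none) ≠ 0 := fun h => by simp [h] at hnone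
  have hb0' : b none ≠ 0 := by simpa using hb0
  refine ⟨-(b (some Q') / b none), ?_, ?_⟩
  · rw [← hs Q hQ, ValuationSubring.mem_comap, ← ValuationSubring.valuation_le_one_iff, map_neg,
      Valuation.map_neg, map_div₀, map_div₀, hnone, div_one]
    exact hint Q' _
  · have : x - algebraMap E L (-(b (some Q') / b none)) = (algebraMap E L (b none))⁻¹ *
        (algebraMap E L (b none) * x + algebraMap E L (b (some Q'))) := by
      rw [map_neg, map_div₀]; field_simp; ring
    rw [this, map_mul, map_inv₀, hnone, inv_one, one_mul]
    exact hQv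

/-- A place above a rational place is rational if the number of places equals the degree. -/
theorem isRationalPlace_of_card_eq {K : Type*} [Field K] [Algebra K E] [Algebra K L]
    [IsScalarTower K E L] [FiniteDimensional E L] {A : ValuationSubring E}
    (hA : IsRationalPlace K A) (s : Finset (ValuationSubring L))
    (hs : ∀ Q ∈ s, Q.comap (algebraMap E L) = A)
    (hcard : s.card = Module.finrank E L) {Q : ValuationSubring L} (hQ : Q ∈ s) :
    IsRationalPlace K Q := by
  have hconst : ∀ c : K, algebraMap K L c ∈ Q := fun c => by
    rw [IsScalarTower.algebraMap_apply K E L]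
    exact algebraMap_mem_of_comap_eq (hs Q hQ) (hA.1.1 c)
  have key : ∀ x : L, IsIntegralOver A x → ∃ c : K, TakesValue Q x c := by
    intro x hx
    obtain ⟨a, ha, hxa⟩ := exists_residue_eq_of_card_eq s hs hcard hQ hx
    obtain ⟨c, hc⟩ := hA.2 a ha
    refine ⟨c, hconst, ?_⟩
    have h1 := valuation_algebraMap_lt_one (hs Q hQ) hc
    rw [map_sub, ← IsScalarTower.algebraMap_apply K E L] at h1
    have h2 := Q.valuation.map_add_lt hxa h1
    rwa [sub_add_sub_cancel] at h2
  refine ⟨⟨hconst, ?_⟩, fun x hx => ?_⟩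
  · intro h
    refine hA.1.2 ?_
    rw [← hs Q hQ, h]
    ext x
    simp [ValuationSubring.mem_comap]
  · obtain ⟨y, hy, hyx, hu⟩ :=
      exists_integral_fraction A (Algebra.IsAlgebraic.isAlgebraic (R := E) x)
    have hy1 := hu Q (hs Q hQ) hx
    obtain ⟨c, hc⟩ := key y hy
    obtain ⟨d, hd⟩ := key _ hyx
    have hc0 : c ≠ 0 := by
      rintro rfl
      exact ((TakesValue.zero_iff hconst).1 hc).ne hy1
    have hy0 : y ≠ 0 := fun h => by simp [h] at hy1
    refine ⟨d / c, ?_⟩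
    have := (hd.div hc hc0).lt_one
    rwa [mul_div_cancel_left₀ _ hy0] at this

end PlacesAbove

/-! ### Total ramification: independence of powers of `π`, and residue fields. -/

section Ramification

variable {E L : Type*} [Field E] [Field L] [Algebra E L] {V : ValuationSubring L}
  {γ : V.ValueGroup} {π : L} {e : ℕ}

/-- Values of `E` are powers of `γ = v(π) ^ e`, so the exponent of `v(π)` in a term determines its
index modulo `e`. -/
theorem eq_of_valuation_mul_pow_eq
    (hE : ∀ x : E, x ≠ 0 → ∃ k : ℤ, V.valuation (algebraMap E L x) = γ ^ k)
    (hγ0 : γ ≠ 0) (hγ : γ < 1) (hπ : V.valuation π ^ e = γ) {c d : E} (hc : c ≠ 0) (hd : d ≠ 0)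
    {i j : ℕ} (hi : i < e) (hj : j < e)
    (h : V.valuation (algebraMap E L c * π ^ i) = V.valuation (algebraMap E L d * π ^ j)) :
    i = j := by
  obtain ⟨k, hk⟩ := hE c hc
  obtain ⟨l, hl⟩ := hE d hd
  have he : e ≠ 0 := by omega
  set ρ := V.valuation π with hρ
  have hρ0 : ρ ≠ 0 := fun h0 => hγ0 (by rw [← hπ, h0, zero_pow he])
  have hρ1 : ρ < 1 := by
    by_contra h1
    have : 1 ≤ ρ ^ e := one_le_pow_of_one_le' (not_lt.1 h1) e
    rw [hπ] at this
    exact absurd hγ (not_lt.2 this)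
  rw [map_mul, map_mul, map_pow, map_pow, hk, hl, ← hρ, ← hπ, ← zpow_natCast, ← zpow_natCast ρ i,
    ← zpow_natCast ρ j, ← zpow_mul, ← zpow_mul, ← zpow_add₀ hρ0, ← zpow_add₀ hρ0] at h
  have h2 := (zpow_right_strictAnti₀ (zero_lt_iff.2 hρ0) hρ1).injective h
  have h3 : (i : ℤ) % e = (j : ℤ) % e := by
    have : (i : ℤ) = j + e * (l - k) := by linear_combination h2
    rw [this, Int.add_mul_emod_self_left]
  rw [Int.emod_eq_of_lt (by positivity) (by exact_mod_cast hi),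
    Int.emod_eq_of_lt (by positivity) (by exact_mod_cast hj)] at h3
  exact_mod_cast h3

/-- If `e · v(π)` generates the value group of `E`, then the valuation of `∑ cᵢ πⁱ`, `i < e`, is the
largest of the valuations of its terms. -/
theorem exists_dominant_term
    (hE : ∀ x : E, x ≠ 0 → ∃ k : ℤ, V.valuation (algebraMap E L x) = γ ^ k)
    (hγ0 : γ ≠ 0) (hγ : γ < 1) (hπ : V.valuation π ^ e = γ) (c : Fin e → E) (hc : ∃ i, c i ≠ 0) :
    ∃ j, c j ≠ 0 ∧
      V.valuation (∑ i, algebraMap E L (c i) * π ^ (i : ℕ)) =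
        V.valuation (algebraMap E L (c j) * π ^ (j : ℕ)) ∧
      ∀ i, V.valuation (algebraMap E L (c i) * π ^ (i : ℕ)) ≤
        V.valuation (algebraMap E L (c j) * π ^ (j : ℕ)) := by
  classical
  obtain ⟨i₀, hi₀⟩ := hc
  have he : e ≠ 0 := by have := i₀.2; omega
  have hπ0 : π ≠ 0 := by
    rintro rfl
    rw [map_zero, zero_pow he] at hπ
    exact hγ0 hπ.symm
  obtain ⟨j, -, hj⟩ := Finset.univ.exists_max_image
    (fun i : Fin e => V.valuation (algebraMap E L (c i) * π ^ (i : ℕ))) ⟨i₀, Finset.mem_univ _⟩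
  have hj0 : c j ≠ 0 := by
    intro h
    have := hj i₀ (Finset.mem_univ _)
    rw [h, map_zero, zero_mul, map_zero, le_zero_iff, map_eq_zero] at this
    simp [hi₀, hπ0] at this
  refine ⟨j, hj0, ?_, fun i => hj i (Finset.mem_univ i)⟩
  refine Valuation.map_sum_eq_of_lt V.valuation (Finset.mem_univ j) fun i hi => ?_
  · refine lt_of_le_of_ne (hj i (Finset.mem_univ i)) fun h => ?_
    have hij : i ≠ j := by simpa using hi
    by_cases hci : c i = 0
    · rw [hci, map_zero, zero_mul, map_zero] at h
      have : algebraMap E L (c j) * π ^ (j : ℕ) = 0 := by simpa using h.symm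
      simp [hj0, hπ0] at this
    · exact hij (Fin.ext (eq_of_valuation_mul_pow_eq hE hγ0 hγ hπ hci hj0 i.2 j.2 h))

theorem linearIndependent_pow_of_valuation
    (hE : ∀ x : E, x ≠ 0 → ∃ k : ℤ, V.valuation (algebraMap E L x) = γ ^ k)
    (hγ0 : γ ≠ 0) (hγ : γ < 1) (hπ : V.valuation π ^ e = γ) :
    LinearIndependent E fun i : Fin e => π ^ (i : ℕ) := by
  rw [Fintype.linearIndependent_iff]
  intro c hc
  by_contra! H
  obtain ⟨j, hj, hsum, -⟩ := exists_dominant_term hE hγ0 hγ hπ c H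
  have he : e ≠ 0 := by have := j.2; omega
  have hπ0 : π ≠ 0 := by
    rintro rfl
    rw [map_zero, zero_pow he] at hπ
    exact hγ0 hπ.symm
  simp only [Algebra.smul_def] at hc
  rw [hc, map_zero, eq_comm, map_eq_zero] at hsum
  simp [hj, hπ0] at hsum

/-- A totally ramified extension has the same residue field. -/
theorem exists_takesValue_of_totally_ramified {K : Type*} [Field K] [Algebra K L]
    (hV : ∀ c : K, algebraMap K L c ∈ V)
    (hE : ∀ x : E, x ≠ 0 → ∃ k : ℤ, V.valuation (algebraMap E L x) = γ ^ k)
    (hγ0 : γ ≠ 0) (hγ : γ < 1) (hπ : V.valuation π ^ e = γ)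
    (he : e = Module.finrank E L) (he0 : 0 < e)
    (hres : ∀ x : E, algebraMap E L x ∈ V → ∃ c : K, TakesValue V (algebraMap E L x) c)
    {x : L} (hx : x ∈ V) : ∃ c : K, TakesValue V x c := by
  have hli := linearIndependent_pow_of_valuation hE hγ0 hγ hπ
  have : Nonempty (Fin e) := ⟨⟨0, he0⟩⟩
  let b := basisOfLinearIndependentOfCardEqFinrank hli (by simpa using he)
  have hb : x = ∑ i, algebraMap E L (b.repr x i) * π ^ (i : ℕ) := by
    conv_lhs => rw [← b.sum_repr x]
    simp [b, Algebra.smul_def]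
  by_cases hx0 : ∃ i, b.repr x i ≠ 0
  swap
  · push Not at hx0
    refine ⟨0, ?_⟩
    rw [TakesValue.zero_iff hV, hb]
    simp [hx0]
  obtain ⟨j, hj, hsum, hmax⟩ := exists_dominant_term hE hγ0 hγ hπ _ hx0
  rw [← hb] at hsum
  have hle : ∀ i, V.valuation (algebraMap E L (b.repr x i) * π ^ (i : ℕ)) ≤ 1 := fun i =>
    ((hmax i).trans_eq hsum.symm).trans ((V.valuation_le_one_iff _).2 hx)
  -- Valuation one is already attained by `1 * π ^ 0`, so no term with positive index can have it;
  -- only the constant term contributes to the residue.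
  have hlt : ∀ i : Fin e, (i : ℕ) ≠ 0 →
      V.valuation (algebraMap E L (b.repr x i) * π ^ (i : ℕ)) < 1 := by
    intro i hi
    refine lt_of_le_of_ne (hle i) fun h => hi ?_
    have hci : b.repr x i ≠ 0 := by
      intro h0
      rw [h0, map_zero, zero_mul, map_zero] at h
      exact zero_ne_one h
    refine eq_of_valuation_mul_pow_eq hE hγ0 hγ hπ hci one_ne_zero i.2 he0 ?_
    rw [h]; simp
  set i₀ : Fin e := ⟨0, he0⟩
  obtain ⟨c, hc⟩ := hres (b.repr x i₀) ((V.valuation_le_one_iff _).1 (by simpa [i₀] using hle i₀))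
  refine ⟨c, ?_⟩
  have h2 : TakesValue V (∑ i ∈ Finset.univ.erase i₀,
      algebraMap E L (b.repr x i) * π ^ (i : ℕ)) (0 : K) := by
    rw [TakesValue.zero_iff hV]
    refine valuation_sum_lt_one _ _ _ fun i hi => hlt i fun h => ?_
    exact (Finset.mem_erase.1 hi).1 (Fin.ext h)
  have h3 := hc.add h2
  rw [add_zero] at h3
  convert h3 using 1
  conv_lhs => rw [hb]
  rw [← Finset.add_sum_erase _ _ (Finset.mem_univ i₀)]
  simp [i₀]

end Ramification

/-! ### Places of `K(t)`. -/

section RationalFunctionField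

variable {K Ω : Type*} [Field K] [Field Ω] [Algebra K Ω]

theorem TakesValue.aeval {V : ValuationSubring Ω} {t : Ω} {c : K} (h : TakesValue V t c)
    (p : K[X]) : TakesValue V (aeval t p) (p.eval c) := by
  induction p using Polynomial.induction_on' with
  | add p q hp hq => simpa using hp.add hq
  | monomial n a => simpa [aeval_monomial] using (TakesValue.const h.const_mem a).mul (h.pow n)

/-- Nonzero elements of `K(t)` are a power of `t - c` times a function with a nonzero value
at `c`. -/
theorem exists_eq_zpow_mul_of_mem_adjoin {V : ValuationSubring Ω} {t : Ω} {c : K}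
    (h : TakesValue V t c) (ht : Transcendental K t) {x : Ω}
    (hx : x ∈ IntermediateField.adjoin K {t}) (hx0 : x ≠ 0) :
    ∃ (k : ℤ) (y : Ω) (d : K), x = (t - algebraMap K Ω c) ^ k * y ∧ TakesValue V y d ∧ d ≠ 0 := by
  have ht0 : t - algebraMap K Ω c ≠ 0 := by
    intro h0
    exact ht (sub_eq_zero.1 h0 ▸ isAlgebraic_algebraMap c)
  have key : ∀ p : K[X], p ≠ 0 → ∃ (k : ℕ) (y : Ω) (d : K),
      aeval t p = (t - algebraMap K Ω c) ^ k * y ∧ TakesValue V y d ∧ d ≠ 0 := by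
    intro p hp
    obtain ⟨q, hq, hq'⟩ := exists_eq_pow_rootMultiplicity_mul_and_not_dvd p hp c
    refine ⟨p.rootMultiplicity c, aeval t q, q.eval c, ?_, h.aeval q, ?_⟩
    · conv_lhs => rw [hq]
      simp
    · rwa [dvd_iff_isRoot] at hq'
  obtain ⟨r, s, rfl⟩ := (IntermediateField.mem_adjoin_simple_iff K x).1 hx
  have hr : r ≠ 0 := by rintro rfl; simp at hx0
  have hs : s ≠ 0 := by rintro rfl; simp at hx0
  obtain ⟨k, y, d, h1, h2, h3⟩ := key r hr
  obtain ⟨k', y', d', h1', h2', h3'⟩ := key s hs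
  refine ⟨(k : ℤ) - k', y / y', d / d', ?_, h2.div h2' h3', div_ne_zero h3 h3'⟩
  rw [h1, h1', zpow_sub₀ ht0, zpow_natCast, zpow_natCast, mul_div_mul_comm]

/-- The discreteness of the value group on `K(t)` required by the ramification lemmas. -/
theorem exists_valuation_eq_zpow {V : ValuationSubring Ω} {t : Ω} {c : K}
    (h : TakesValue V t c) (ht : Transcendental K t) {x : Ω}
    (hx : x ∈ IntermediateField.adjoin K {t}) (hx0 : x ≠ 0) :
    ∃ k : ℤ, V.valuation x = V.valuation (t - algebraMap K Ω c) ^ k := by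
  obtain ⟨k, y, d, rfl, h2, h3⟩ := exists_eq_zpow_mul_of_mem_adjoin h ht hx hx0
  exact ⟨k, by rw [map_mul, map_zpow₀, h2.valuation_eq_one h3, mul_one]⟩

theorem exists_takesValue_of_mem_adjoin {V : ValuationSubring Ω} {t : Ω} {c : K}
    (h : TakesValue V t c) (ht : Transcendental K t) {x : Ω}
    (hx : x ∈ IntermediateField.adjoin K {t}) (hxV : x ∈ V) : ∃ d : K, TakesValue V x d := by
  by_cases hx0 : x = 0
  · exact ⟨0, by rw [TakesValue.zero_iff h.const_mem, hx0]; simp⟩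
  obtain ⟨k, y, d, rfl, h2, h3⟩ := exists_eq_zpow_mul_of_mem_adjoin h ht hx hx0
  have ht0 : t - algebraMap K Ω c ≠ 0 := by
    intro h0
    exact ht (sub_eq_zero.1 h0 ▸ isAlgebraic_algebraMap c)
  have hle := (V.valuation_le_one_iff _).2 hxV
  rw [map_mul, map_zpow₀, h2.valuation_eq_one h3, mul_one] at hle
  have hk : 0 ≤ k := by
    by_contra hk
    have h4 := one_lt_zpow_of_neg₀ (zero_lt_iff.2 (by simpa using ht0)) h.lt_one (not_le.1 hk)
    exact absurd hle (not_le.2 h4)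
  lift k to ℕ using hk
  rw [zpow_natCast]
  exact ⟨_, ((TakesValue.sub_const_iff.2 h).pow k).mul h2⟩

end RationalFunctionField

/-! ### The coefficients of `Φ` and the identity behind its linear factor. -/

section Coefficients

variable {R : Type*} [CommRing R]

/-- The coefficient of `T ^ 3` in `Φ(a, x, T)`. -/
def phi₃ (a x : R) : R := x ^ 3 + a ^ 24 * x ^ 2 + a ^ 4 * x + a ^ 9

/-- The coefficient of `T ^ 2` in `Φ(a, x, T)`. -/
def phi₂ (a x : R) : R := a ^ 17 * x ^ 3 + a ^ 29 * x ^ 2 + x + a ^ 30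

/-- The coefficient of `T` in `Φ(a, x, T)`. -/
def phi₁ (a x : R) : R := a ^ 30 * x ^ 3 + a ^ 12 * x ^ 2 + a ^ 30 * x + a ^ 17

/-- The constant coefficient of `Φ(a, x, T)`. -/
def phi₀ (a x : R) : R := a ^ 4 * x ^ 3 + a ^ 14 * x ^ 2 + a ^ 19

theorem Phi_eq (a x : R) :
    Phi a x = C (phi₃ a x) * X ^ 3 + C (phi₂ a x) * X ^ 2 + C (phi₁ a x) * X + C (phi₀ a x) := rfl

theorem eval_Phi (a x y : R) :
    (Phi a x).eval y = phi₃ a x * y ^ 3 + phi₂ a x * y ^ 2 + phi₁ a x * y + phi₀ a x := by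
  simp [Phi_eq]

theorem map_phi₃ {S : Type*} [CommRing S] (f : R →+* S) (a x : R) :
    f (phi₃ a x) = phi₃ (f a) (f x) := by simp [phi₃]

theorem map_phi₂ {S : Type*} [CommRing S] (f : R →+* S) (a x : R) :
    f (phi₂ a x) = phi₂ (f a) (f x) := by simp [phi₂]

theorem map_phi₁ {S : Type*} [CommRing S] (f : R →+* S) (a x : R) :
    f (phi₁ a x) = phi₁ (f a) (f x) := by simp [phi₁]

theorem map_phi₀ {S : Type*} [CommRing S] (f : R →+* S) (a x : R) :
    f (phi₀ a x) = phi₀ (f a) (f x) := by simp [phi₀]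

variable [CharP R 2]

/-- `X⁵ + X² + 1` is irreducible over `𝔽₂`, so its roots lie in `𝔽₃₂`. Exponents of `a` therefore
matter only modulo 31, and the twist multiplies them by 8. -/
theorem pow_thirtyone {a : R} (ha : a ^ 5 + a ^ 2 + 1 = 0) : a ^ 31 = 1 := by grind

theorem pow_eq_pow_mod_thirtyone {a : R} (ha : a ^ 5 + a ^ 2 + 1 = 0) (n : ℕ) :
    a ^ n = a ^ (n % 31) :=
  pow_eq_pow_mod n (pow_thirtyone ha)

/-- The Frobenius twist of the parameter satisfies the same equation. -/
theorem twist_eq {a : R} (ha : a ^ 5 + a ^ 2 + 1 = 0) :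
    (a ^ 8) ^ 5 + (a ^ 8) ^ 2 + 1 = 0 := by
  rw [← pow_mul, ← pow_mul, pow_eq_pow_mod_thirtyone ha (8 * 5)]
  grind

theorem twist_pow_eq {a : R} (ha : a ^ 5 + a ^ 2 + 1 = 0) (n : ℕ) :
    (a ^ 8 ^ n) ^ 5 + (a ^ 8 ^ n) ^ 2 + 1 = 0 := by
  induction n with
  | zero => simpa using ha
  | succ n ih => rw [pow_succ 8 n, pow_mul]; exact twist_eq ih

/-- Homogeneous form of the statement that `linFactor a x` divides `Φ(a⁸, y, T)` whenever
`Φ(a, x, y) = 0`. -/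
theorem phi_linFactor_identity {a : R} (ha : a ^ 5 + a ^ 2 + 1 = 0) (x y : R) :
    phi₃ (a ^ 8) y * (a ^ 28 * x + a ^ 27) ^ 3 +
      phi₂ (a ^ 8) y * (a ^ 28 * x + a ^ 27) ^ 2 * (x + a ^ 25) +
      phi₁ (a ^ 8) y * (a ^ 28 * x + a ^ 27) * (x + a ^ 25) ^ 2 +
      phi₀ (a ^ 8) y * (x + a ^ 25) ^ 3 =
    a ^ 10 * (phi₃ a x * y ^ 3 + phi₂ a x * y ^ 2 + phi₁ a x * y + phi₀ a x) := by
  have e3 : phi₃ (a ^ 8) y = y ^ 3 + a ^ 6 * y ^ 2 + a * y + a ^ 10 := by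
    simp only [phi₃, ← pow_mul]
    rw [pow_eq_pow_mod_thirtyone ha (8 * 24), pow_eq_pow_mod_thirtyone ha (8 * 4),
      pow_eq_pow_mod_thirtyone ha (8 * 9)]
    norm_num
  have e2 : phi₂ (a ^ 8) y = a ^ 12 * y ^ 3 + a ^ 15 * y ^ 2 + y + a ^ 23 := by
    simp only [phi₂, ← pow_mul]
    rw [pow_eq_pow_mod_thirtyone ha (8 * 17), pow_eq_pow_mod_thirtyone ha (8 * 29),
      pow_eq_pow_mod_thirtyone ha (8 * 30)]
  have e1 : phi₁ (a ^ 8) y = a ^ 23 * y ^ 3 + a ^ 3 * y ^ 2 + a ^ 23 * y + a ^ 12 := by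
    simp only [phi₁, ← pow_mul]
    rw [pow_eq_pow_mod_thirtyone ha (8 * 17), pow_eq_pow_mod_thirtyone ha (8 * 12),
      pow_eq_pow_mod_thirtyone ha (8 * 30)]
  have e0 : phi₀ (a ^ 8) y = a * y ^ 3 + a ^ 19 * y ^ 2 + a ^ 28 := by
    simp only [phi₀, ← pow_mul]
    rw [pow_eq_pow_mod_thirtyone ha (8 * 4), pow_eq_pow_mod_thirtyone ha (8 * 14),
      pow_eq_pow_mod_thirtyone ha (8 * 19)]
    norm_num
  rw [e0, e1, e2, e3]
  simp only [phi₀, phi₁, phi₂, phi₃]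
  clear e0 e1 e2 e3
  -- All powers are expressed in the basis `1, a, …, a⁴` to keep the final polynomial identity of
  -- small degree in `a`.
  rw [show a ^ 28 = a ^ 4 + a ^ 2 + a by grind, show a ^ 27 = a ^ 3 + a + 1 by grind,
    show a ^ 25 = a ^ 4 + a ^ 3 + 1 by grind, show a ^ 12 = a ^ 3 + a ^ 2 + a by grind,
    show a ^ 15 = a ^ 4 + a ^ 3 + a ^ 2 + a + 1 by grind,
    show a ^ 23 = a ^ 3 + a ^ 2 + a + 1 by grind, show a ^ 19 = a ^ 2 + a by grind,
    show a ^ 24 = a ^ 4 + a ^ 3 + a ^ 2 + a by grind, show a ^ 9 = a ^ 4 + a ^ 3 + a by grind,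
    show a ^ 17 = a ^ 4 + a + 1 by grind, show a ^ 29 = a ^ 3 + 1 by grind,
    show a ^ 30 = a ^ 4 + a by grind, show a ^ 14 = a ^ 4 + a ^ 3 + a ^ 2 + 1 by grind,
    show a ^ 10 = a ^ 4 + 1 by grind, show a ^ 6 = a ^ 3 + a by grind]
  grind

end Coefficients

/-! ### Explicit factorizations of `Φ(a, c, T)` at the relevant constants. -/

section Splitting

variable {K : Type*} [Field K]

/-- `Φ(a, x, T)` has degree three and the roots `r`, `s`, `t`, in characteristic two. -/
structure PhiSplits (a x r s t : K) : Prop where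
  ne_zero : phi₃ a x ≠ 0
  two : phi₂ a x = phi₃ a x * (r + s + t)
  one : phi₁ a x = phi₃ a x * (r * s + r * t + s * t)
  zero : phi₀ a x = phi₃ a x * (r * s * t)

theorem PhiSplits.rotate {a x r s t : K} (h : PhiSplits a x r s t) : PhiSplits a x s t r :=
  ⟨h.ne_zero, by rw [h.two]; ring, by rw [h.one]; ring, by rw [h.zero]; ring⟩

/-- The values `p(a, ω)` taken by `u₁` above the completely split places. -/
def pVal (a w : K) : K := a ^ 20 + a ^ 5 * w

/-- The values `q(a, ω)` of `u₀` at completely split places. -/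
def qVal (a w : K) : K := a ^ 18 + a ^ 20 * w

variable [CharP K 2] {a w : K}

theorem conj_eq (hw : w ^ 2 + w + 1 = 0) : (w + 1) ^ 2 + (w + 1) + 1 = 0 := by grind

theorem add_one_add_one (w : K) : w + 1 + 1 = w := by grind

/-- Because `8 · 18 ≡ 20` and `8 · 20 ≡ 5` modulo 31. This lets a value `p` at one level serve as a
value `q` for the twisted parameter at the next. -/
theorem pVal_eq_qVal_twist (ha : a ^ 5 + a ^ 2 + 1 = 0) (w : K) : pVal a w = qVal (a ^ 8) w := by
  simp only [pVal, qVal, ← pow_mul]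
  rw [pow_eq_pow_mod_thirtyone ha (8 * 18), pow_eq_pow_mod_thirtyone ha (8 * 20)]

theorem phiSplits_five (ha : a ^ 5 + a ^ 2 + 1 = 0) (hw : w ^ 2 + w + 1 = 0) :
    PhiSplits a (a ^ 5) (a ^ 30) (pVal a w) (pVal a (w + 1)) := by
  constructor <;> simp only [phi₀, phi₁, phi₂, phi₃, pVal] <;> grind

theorem phiSplits_twentyseven (ha : a ^ 5 + a ^ 2 + 1 = 0) :
    PhiSplits a (a ^ 27) (a ^ 9) (a ^ 30) (a ^ 22) := by
  constructor <;> simp only [phi₀, phi₁, phi₂, phi₃] <;> grind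

/-- The triple root has two uses: it forces total ramification of `F₁/F₀` above `α²⁶`, and, since
`a²² = (a⁸)²⁶`, it is the source of the exceptional state `(a²⁷, a²²)`. -/
theorem phiSplits_twentysix (ha : a ^ 5 + a ^ 2 + 1 = 0) :
    PhiSplits a (a ^ 26) (a ^ 30) (a ^ 30) (a ^ 30) := by
  constructor <;> simp only [phi₀, phi₁, phi₂, phi₃] <;> grind

theorem phiSplits_qVal (ha : a ^ 5 + a ^ 2 + 1 = 0) (hw : w ^ 2 + w + 1 = 0) :
    PhiSplits a (qVal a w) (a ^ 9) (pVal a w) (pVal a (w + 1)) := by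
  constructor <;> simp only [phi₀, phi₁, phi₂, phi₃, pVal, qVal] <;> grind

end Splitting

/-! ### The quadratic factor made explicit. -/

section QuadraticFactor

/-- The root of `linFactor a x`, in characteristic two. -/
def linRoot {E : Type*} [Field E] (a x : E) : E := (a ^ 28 * x + a ^ 27) / (x + a ^ 25)

/-- The linear coefficient of the monic multiple of `quadFactor a x y`. -/
def quadB {E : Type*} [Field E] (a x y : E) : E :=
  phi₂ (a ^ 8) y / phi₃ (a ^ 8) y + linRoot a x

/-- The constant coefficient of the monic multiple of `quadFactor a x y`. -/
def quadC {E : Type*} [Field E] (a x y : E) : E :=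
  phi₁ (a ^ 8) y / phi₃ (a ^ 8) y + linRoot a x * quadB a x y

theorem map_linRoot {E L : Type*} [Field E] [Field L] (f : E →+* L) (a x : E) :
    f (linRoot a x) = linRoot (f a) (f x) := by simp [linRoot]

theorem map_quadB {E L : Type*} [Field E] [Field L] (f : E →+* L) (a x y : E) :
    f (quadB a x y) = quadB (f a) (f x) (f y) := by
  simp [quadB, map_phi₂, map_phi₃, map_linRoot]

theorem map_quadC {E L : Type*} [Field E] [Field L] (f : E →+* L) (a x y : E) :
    f (quadC a x y) = quadC (f a) (f x) (f y) := by
  simp [quadC, map_phi₁, map_phi₃, map_linRoot, map_quadB]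

section Factorization

variable {E : Type*} [Field E] [CharP E 2] {a x y : E}

/-- By `phi_linFactor_identity`, `linRoot a x` is a root of `Φ(a⁸, y, T)`; `quadB` and `quadC` are
the coefficients produced by synthetic division at that root. -/
theorem Phi_eq_linFactor_mul (ha : a ^ 5 + a ^ 2 + 1 = 0) (hxy : (Phi a x).IsRoot y)
    (hx : x + a ^ 25 ≠ 0) (hy : phi₃ (a ^ 8) y ≠ 0) :
    Phi (a ^ 8) y = linFactor a x *
      (C (phi₃ (a ^ 8) y / (x + a ^ 25)) * (X ^ 2 + C (quadB a x y) * X + C (quadC a x y))) := by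
  have hid := phi_linFactor_identity ha x y
  rw [IsRoot.def, eval_Phi] at hxy
  rw [hxy, mul_zero] at hid
  set L3 := phi₃ (a ^ 8) y
  set L2 := phi₂ (a ^ 8) y
  set L1 := phi₁ (a ^ 8) y
  set L0 := phi₀ (a ^ 8) y
  set l1 := x + a ^ 25
  set l0 := a ^ 28 * x + a ^ 27
  have h2 : (2 : E) = 0 := CharTwo.two_eq_zero
  have hB : quadB a x y = L2 / L3 + l0 / l1 := rfl
  have hC : quadC a x y = L1 / L3 + l0 / l1 * quadB a x y := rfl
  have e2 : L2 = l1 * (L3 / l1 * quadB a x y) + l0 * (L3 / l1) := by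
    rw [hB]; field_simp; linear_combination (-(L3 * l0)) * h2
  have e1 : L1 = l1 * (L3 / l1 * quadC a x y) + l0 * (L3 / l1 * quadB a x y) := by
    rw [hC]; field_simp; linear_combination (-(quadB a x y * L3 * l0)) * h2
  have e0 : L0 = l0 * (L3 / l1 * quadC a x y) := by
    rw [hC, hB]; field_simp
    linear_combination hid - (L3 * l0 ^ 3 + L2 * l0 ^ 2 * l1 + L1 * l0 * l1 ^ 2) * h2
  have e3 : L3 = l1 * (L3 / l1) := by field_simp
  rw [Phi_eq, linFactor]
  change C L3 * X ^ 3 + C L2 * X ^ 2 + C L1 * X + C L0 = (C l1 * X + C l0) * _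
  have f3 := congrArg C e3
  have f2 := congrArg C e2
  have f1 := congrArg C e1
  have f0 := congrArg C e0
  simp only [C_add, C_mul] at f0 f1 f2 f3
  linear_combination X ^ 3 * f3 + X ^ 2 * f2 + X * f1 + f0

/-- `quadFactor` is a Euclidean quotient; the two nonvanishing conditions make the divisor of degree
one and the leading coefficient of the quotient nonzero. -/
theorem quadFactor_isRoot_iff (ha : a ^ 5 + a ^ 2 + 1 = 0) (hxy : (Phi a x).IsRoot y)
    (hx : x + a ^ 25 ≠ 0) (hy : phi₃ (a ^ 8) y ≠ 0) (z : E) :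
    (quadFactor a x y).IsRoot z ↔ z ^ 2 + quadB a x y * z + quadC a x y = 0 := by
  have hlin : linFactor a x ≠ 0 := by
    intro h
    have := congrArg (fun p => p.coeff 1) h
    simp only [linFactor, coeff_add, coeff_C_mul, coeff_X_one, coeff_C_succ, coeff_zero, mul_one,
      add_zero] at this
    exact hx this
  rw [quadFactor, Phi_eq_linFactor_mul ha hxy hx hy, mul_div_cancel_left₀ _ hlin, IsRoot.def]
  simp [hx, hy]

theorem Phi_isRoot_of_quad (ha : a ^ 5 + a ^ 2 + 1 = 0) (hxy : (Phi a x).IsRoot y)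
    (hx : x + a ^ 25 ≠ 0) (hy : phi₃ (a ^ 8) y ≠ 0) {z : E}
    (hz : z ^ 2 + quadB a x y * z + quadC a x y = 0) : (Phi (a ^ 8) y).IsRoot z := by
  rw [Phi_eq_linFactor_mul ha hxy hx hy, IsRoot.def, eval_mul, eval_mul]
  simp [hz]

end Factorization

section Values

variable {K F : Type*} [Field K] [Field F] [Algebra K F] {A : ValuationSubring F} {x y : F}
  {a c d : K}

theorem TakesValue.phi₃ (h : TakesValue A x c) (a : K) :
    TakesValue A (phi₃ (algebraMap K F a) x) (phi₃ a c) := by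
  have ha (n : ℕ) := (TakesValue.const h.const_mem a).pow n
  exact (((h.pow 3).add ((ha 24).mul (h.pow 2))).add ((ha 4).mul h)).add (ha 9)

theorem TakesValue.phi₂ (h : TakesValue A x c) (a : K) :
    TakesValue A (phi₂ (algebraMap K F a) x) (phi₂ a c) := by
  have ha (n : ℕ) := (TakesValue.const h.const_mem a).pow n
  exact ((((ha 17).mul (h.pow 3)).add ((ha 29).mul (h.pow 2))).add h).add (ha 30)

theorem TakesValue.phi₁ (h : TakesValue A x c) (a : K) :
    TakesValue A (phi₁ (algebraMap K F a) x) (phi₁ a c) := by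
  have ha (n : ℕ) := (TakesValue.const h.const_mem a).pow n
  exact ((((ha 30).mul (h.pow 3)).add ((ha 12).mul (h.pow 2))).add ((ha 30).mul h)).add (ha 17)

theorem TakesValue.phi₀ (h : TakesValue A x c) (a : K) :
    TakesValue A (phi₀ (algebraMap K F a) x) (phi₀ a c) := by
  have ha (n : ℕ) := (TakesValue.const h.const_mem a).pow n
  exact (((ha 4).mul (h.pow 3)).add ((ha 14).mul (h.pow 2))).add (ha 19)

theorem TakesValue.linRoot (h : TakesValue A x c) (hc : c + a ^ 25 ≠ 0) :
    TakesValue A (linRoot (algebraMap K F a) x) (linRoot a c) := by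
  have ha (n : ℕ) := (TakesValue.const h.const_mem a).pow n
  exact (((ha 28).mul h).add (ha 27)).div (h.add (ha 25)) hc

theorem TakesValue.quadB (h : TakesValue A x c) (h' : TakesValue A y d) (hc : c + a ^ 25 ≠ 0)
    (hd : DrinfeldTower.phi₃ (a ^ 8) d ≠ 0) :
    TakesValue A (quadB (algebraMap K F a) x y) (quadB a c d) := by
  have h2 := (h'.phi₂ (a ^ 8)).div (h'.phi₃ (a ^ 8)) hd
  rw [map_pow] at h2
  exact h2.add (h.linRoot hc)

theorem TakesValue.quadC (h : TakesValue A x c) (h' : TakesValue A y d) (hc : c + a ^ 25 ≠ 0)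
    (hd : DrinfeldTower.phi₃ (a ^ 8) d ≠ 0) :
    TakesValue A (quadC (algebraMap K F a) x y) (quadC a c d) := by
  have h2 := (h'.phi₁ (a ^ 8)).div (h'.phi₃ (a ^ 8)) hd
  rw [map_pow] at h2
  exact h2.add ((h.linRoot hc).mul (h.quadB h' hc hd))

end Values

end QuadraticFactor

/-! ### Transition tables for the values of consecutive generators. -/

section Steps

variable {K : Type*} [Field K]

/-- `r` is the root of `linFactor a x`, and `r`, `s`, `t` are the roots of `Φ(a⁸, y, T)`. -/
structure Step (a x y r s t : K) : Prop where
  ne_zero : x + a ^ 25 ≠ 0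
  lin : a ^ 28 * x + a ^ 27 = r * (x + a ^ 25)
  splits : PhiSplits (a ^ 8) y r s t

theorem Step.linRoot_eq {a x y r s t : K} (h : Step a x y r s t) : linRoot a x = r := by
  rw [linRoot, h.lin, mul_div_cancel_right₀ _ h.ne_zero]

theorem Step.quadB_eq [CharP K 2] {a x y r s t : K} (h : Step a x y r s t) :
    quadB a x y = s + t := by
  rw [quadB, h.linRoot_eq, h.splits.two, mul_div_cancel_left₀ _ h.splits.ne_zero]
  linear_combination r * (CharTwo.two_eq_zero : (2 : K) = 0)

theorem Step.quadC_eq [CharP K 2] {a x y r s t : K} (h : Step a x y r s t) :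
    quadC a x y = s * t := by
  rw [quadC, h.linRoot_eq, h.quadB_eq, h.splits.one, mul_div_cancel_left₀ _ h.splits.ne_zero]
  linear_combination (r * s + r * t) * (CharTwo.two_eq_zero : (2 : K) = 0)

/-- The values of two consecutive generators at the completely split places. -/
inductive SplitState (a : K) : K → K → Prop
  | five_p (w : K) (hw : w ^ 2 + w + 1 = 0) : SplitState a (a ^ 5) (pVal a w)
  | five_thirty : SplitState a (a ^ 5) (a ^ 30)
  | twentyseven_nine : SplitState a (a ^ 27) (a ^ 9)
  | twentyseven_thirty : SplitState a (a ^ 27) (a ^ 30)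
  | twentyseven_twentytwo : SplitState a (a ^ 27) (a ^ 22)
  | twentysix_thirty : SplitState a (a ^ 26) (a ^ 30)
  | q_nine (w : K) (hw : w ^ 2 + w + 1 = 0) : SplitState a (qVal a w) (a ^ 9)
  | q_p (w : K) (hw : w ^ 2 + w + 1 = 0) : SplitState a (qVal a w) (pVal a w)
  | q_p_conj (w : K) (hw : w ^ 2 + w + 1 = 0) : SplitState a (qVal a w) (pVal a (w + 1))

/-- The values `x`, `y` of two consecutive generators at a totally ramified place, with the simple
root `r` of `Φ(a, x, T)`. -/
inductive CuspState (a : K) : K → K → K → Prop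
  | twentyeight : CuspState a (a ^ 28) (a ^ 28) (a ^ 7)
  | nineteen : CuspState a (a ^ 19) (a ^ 18) (a ^ 28)
  | ten : CuspState a (a ^ 10) (a ^ 17) (a ^ 18)
  | six : CuspState a (a ^ 6) (a ^ 4) (a ^ 17)
  | sixteen : CuspState a (a ^ 16) (a ^ 7) (a ^ 4)

/-- The difference quotient of `Φ(a, x, y)` with respect to `x`. -/
def phiQuot {R : Type*} [CommRing R] (a x k y : R) : R :=
  (x ^ 2 + x * k + k ^ 2 + a ^ 24 * (x + k) + a ^ 4) * y ^ 3 +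
    (a ^ 17 * (x ^ 2 + x * k + k ^ 2) + a ^ 29 * (x + k) + 1) * y ^ 2 +
    (a ^ 30 * (x ^ 2 + x * k + k ^ 2) + a ^ 12 * (x + k) + a ^ 30) * y +
    (a ^ 4 * (x ^ 2 + x * k + k ^ 2) + a ^ 14 * (x + k))

/-- On the curve this compares `x - k` with `Φ(a, k, y)`. On the diagonal `x = k` the quotient is
the partial derivative in `x`, so its nonvanishing expresses smoothness. -/
theorem eval_Phi_sub {R : Type*} [CommRing R] (a x k y : R) :
    (Phi a x).eval y - (Phi a k).eval y = (x - k) * phiQuot a x k y := by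
  simp only [eval_Phi, phi₀, phi₁, phi₂, phi₃, phiQuot]
  ring

theorem TakesValue.phiQuot {F : Type*} [Field F] [Algebra K F] {A : ValuationSubring F} {x y : F}
    {c d : K} (h : TakesValue A x c) (h' : TakesValue A y d) (a : K) :
    TakesValue A (phiQuot (algebraMap K F a) x (algebraMap K F c) y) (phiQuot a c c d) := by
  have ha (n : ℕ) := (TakesValue.const h.const_mem a).pow n
  have hc := TakesValue.const h.const_mem c
  have h1 : TakesValue A (1 : F) (1 : K) := by simpa using TakesValue.const h.const_mem (1 : K)
  have e2 := ((h.pow 2).add (h.mul hc)).add (hc.pow 2)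
  have e1 := h.add hc
  exact ((((((e2.add ((ha 24).mul e1)).add (ha 4)).mul (h'.pow 3))).add
    (((((ha 17).mul e2).add ((ha 29).mul e1)).add h1).mul (h'.pow 2))).add
    (((((ha 30).mul e2).add ((ha 12).mul e1)).add (ha 30)).mul h')).add
    (((ha 4).mul e2).add ((ha 14).mul e1))

variable [CharP K 2] {a : K}

theorem pow_eq_twist_pow (ha : a ^ 5 + a ^ 2 + 1 = 0) {m n : ℕ} (h : m = 8 * n % 31) :
    a ^ m = (a ^ 8) ^ n := by
  rw [← pow_mul, pow_eq_pow_mod_thirtyone ha (8 * n), h]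

theorem CuspState.splits (ha : a ^ 5 + a ^ 2 + 1 = 0) {x y r : K} (h : CuspState a x y r) :
    PhiSplits a x r y y := by
  cases h <;> constructor <;> simp only [phi₀, phi₁, phi₂, phi₃] <;> grind

theorem CuspState.phiQuot_ne_zero (ha : a ^ 5 + a ^ 2 + 1 = 0) {x y r : K}
    (h : CuspState a x y r) : phiQuot a x x y ≠ 0 := by
  cases h <;> simp only [phiQuot] <;> grind

theorem CuspState.ne (ha : a ^ 5 + a ^ 2 + 1 = 0) {x y r : K} (h : CuspState a x y r) :
    y ≠ r := by
  cases h <;> grind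

/-- The five states form a cycle, with exponents of the first value `28 → 19 → 10 → 6 → 16 → 28`
relative to the current parameter. The linear factor removes the simple root, so the quadratic
factor reduces to the square of `T - s`. -/
theorem CuspState.step (ha : a ^ 5 + a ^ 2 + 1 = 0) {x y r : K} (h : CuspState a x y r) :
    ∃ s r', CuspState (a ^ 8) y s r' ∧ Step a x y r' s s := by
  suffices H : ∃ s r', CuspState (a ^ 8) y s r' ∧ x + a ^ 25 ≠ 0 ∧
      a ^ 28 * x + a ^ 27 = r' * (x + a ^ 25) by
    obtain ⟨s, r', h1, h2, h3⟩ := H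
    exact ⟨s, r', h1, h2, h3, h1.splits (twist_eq ha)⟩
  cases h with
  | twentyeight =>
    refine ⟨(a ^ 8) ^ 18, (a ^ 8) ^ 28, ?_, ?_, ?_⟩
    · rw [pow_eq_twist_pow ha (m := 28) (n := 19) (by norm_num)]
      exact .nineteen
    · grind
    · rw [← pow_eq_twist_pow ha (m := 7) (n := 28) (by norm_num)]
      grind
  | nineteen =>
    refine ⟨(a ^ 8) ^ 17, (a ^ 8) ^ 18, ?_, ?_, ?_⟩
    · rw [pow_eq_twist_pow ha (m := 18) (n := 10) (by norm_num)]
      exact .ten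
    · grind
    · rw [← pow_eq_twist_pow ha (m := 20) (n := 18) (by norm_num)]
      grind
  | ten =>
    refine ⟨(a ^ 8) ^ 4, (a ^ 8) ^ 17, ?_, ?_, ?_⟩
    · rw [pow_eq_twist_pow ha (m := 17) (n := 6) (by norm_num)]
      exact .six
    · grind
    · rw [← pow_eq_twist_pow ha (m := 12) (n := 17) (by norm_num)]
      grind
  | six =>
    refine ⟨(a ^ 8) ^ 7, (a ^ 8) ^ 4, ?_, ?_, ?_⟩
    · rw [pow_eq_twist_pow ha (m := 4) (n := 16) (by norm_num)]
      exact .sixteen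
    · grind
    · rw [← pow_eq_twist_pow ha (m := 1) (n := 4) (by norm_num)]
      grind
  | sixteen =>
    refine ⟨(a ^ 8) ^ 28, (a ^ 8) ^ 7, ?_, ?_, ?_⟩
    · rw [pow_eq_twist_pow ha (m := 7) (n := 28) (by norm_num)]
      exact .twentyeight
    · grind
    · rw [← pow_eq_twist_pow ha (m := 25) (n := 7) (by norm_num)]
      grind

/-- Away from one exceptional case, the two values of the next generator are distinct. -/
theorem SplitState.step (ha : a ^ 5 + a ^ 2 + 1 = 0) (hex : ∃ w : K, w ^ 2 + w + 1 = 0) {x y : K}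
    (h : SplitState a x y) :
    (x = a ^ 27 ∧ y = a ^ 22) ∨ ∃ r s t, Step a x y r s t ∧ s ≠ t ∧
      SplitState (a ^ 8) y s ∧ SplitState (a ^ 8) y t := by
  have hb := twist_eq ha
  have h9 : a ^ 9 = (a ^ 8) ^ 5 := pow_eq_twist_pow ha (by norm_num)
  have h30 : a ^ 30 = (a ^ 8) ^ 27 := pow_eq_twist_pow ha (by norm_num)
  have h10 : a ^ 10 = (a ^ 8) ^ 9 := pow_eq_twist_pow ha (by norm_num)
  have h23 : a ^ 23 = (a ^ 8) ^ 30 := pow_eq_twist_pow ha (by norm_num)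
  have h21 : a ^ 21 = (a ^ 8) ^ 22 := pow_eq_twist_pow ha (by norm_num)
  have hne1 : (a ^ 8) ^ 30 ≠ (a ^ 8) ^ 22 := by rw [← h23, ← h21]; grind
  have hne2 : (a ^ 8) ^ 9 ≠ (a ^ 8) ^ 22 := by rw [← h10, ← h21]; grind
  have hne3 : (a ^ 8) ^ 9 ≠ (a ^ 8) ^ 30 := by rw [← h10, ← h23]; grind
  have hp : ∀ w : K, pVal (a ^ 8) w ≠ pVal (a ^ 8) (w + 1) := by
    intro w h
    have : (a ^ 8) ^ 5 = 0 := by rw [pVal, pVal] at h; linear_combination -h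
    grind
  have hp9 : ∀ w : K, w ^ 2 + w + 1 = 0 → (a ^ 8) ^ 9 ≠ pVal (a ^ 8) w := by
    intro w hw
    generalize a ^ 8 = b at hb
    rw [pVal]; grind
  have hp30 : ∀ w : K, w ^ 2 + w + 1 = 0 → (a ^ 8) ^ 30 ≠ pVal (a ^ 8) w := by
    intro w hw
    generalize a ^ 8 = b at hb
    rw [pVal]; grind
  have hlin5 : a ^ 28 * a ^ 5 + a ^ 27 = (a ^ 8) ^ 9 * (a ^ 5 + a ^ 25) := by rw [← h10]; grind
  have hlin27 : a ^ 28 * a ^ 27 + a ^ 27 = (a ^ 8) ^ 30 * (a ^ 27 + a ^ 25) := by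
    rw [← h23]; grind
  have hlin26 : a ^ 28 * a ^ 26 + a ^ 27 = (a ^ 8) ^ 22 * (a ^ 26 + a ^ 25) := by
    rw [← h21]; grind
  have hq0 : ∀ w : K, w ^ 2 + w + 1 = 0 → qVal a w + a ^ 25 ≠ 0 := by
    intro w hw; rw [qVal]; grind
  have hlinq : ∀ w : K, w ^ 2 + w + 1 = 0 →
      a ^ 28 * qVal a w + a ^ 27 = pVal (a ^ 8) w * (qVal a w + a ^ 25) := by
    intro w hw
    simp only [pVal, qVal, ← pow_mul]
    rw [pow_eq_pow_mod_thirtyone ha (8 * 20), pow_eq_pow_mod_thirtyone ha (8 * 5)]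
    grind
  cases h with
  | five_p w hw =>
    right
    rw [pVal_eq_qVal_twist ha]
    exact ⟨_, _, _, ⟨by grind, hlin5, phiSplits_qVal hb hw⟩, hp w, .q_p w hw, .q_p_conj w hw⟩
  | five_thirty =>
    right
    rw [h30]
    exact ⟨_, _, _, ⟨by grind, hlin5, phiSplits_twentyseven hb⟩, hne1, .twentyseven_thirty,
      .twentyseven_twentytwo⟩
  | twentyseven_nine =>
    right
    -- The two remaining roots are conjugate over `𝔽₄`; a primitive cube root of unity in `K` makes
    -- them available.
    obtain ⟨w, hw⟩ := hex
    rw [h9]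
    exact ⟨_, _, _, ⟨by grind, hlin27, phiSplits_five hb hw⟩, hp w, .five_p w hw,
      .five_p _ (conj_eq hw)⟩
  | twentyseven_thirty =>
    right
    rw [h30]
    -- `rotate` moves the root taken by the linear factor to the front; the last two are the roots
    -- of the quadratic.
    exact ⟨_, _, _, ⟨by grind, hlin27, (phiSplits_twentyseven hb).rotate⟩, hne2.symm,
      .twentyseven_twentytwo, .twentyseven_nine⟩
  -- Here `y = (a⁸)²⁶`, where `Φ(a⁸, y, T)` has a triple root, so distinct roots are impossible.
  | twentyseven_twentytwo => exact Or.inl ⟨rfl, rfl⟩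
  | twentysix_thirty =>
    right
    rw [h30]
    exact ⟨_, _, _, ⟨by grind, hlin26, (phiSplits_twentyseven hb).rotate.rotate⟩, hne3,
      .twentyseven_nine, .twentyseven_thirty⟩
  | q_nine w hw =>
    right
    rw [h9]
    exact ⟨_, _, _, ⟨hq0 w hw, hlinq w hw, (phiSplits_five hb hw).rotate⟩,
      (hp30 _ (conj_eq hw)).symm, .five_p _ (conj_eq hw), .five_thirty⟩
  | q_p w hw =>
    right
    rw [pVal_eq_qVal_twist ha]
    exact ⟨_, _, _, ⟨hq0 w hw, hlinq w hw, (phiSplits_qVal hb hw).rotate⟩,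
      (hp9 _ (conj_eq hw)).symm, .q_p_conj w hw, .q_nine w hw⟩
  | q_p_conj w hw =>
    right
    rw [pVal_eq_qVal_twist ha]
    have h1 := (phiSplits_qVal hb (conj_eq hw)).rotate.rotate
    rw [add_one_add_one] at h1
    have h2 := SplitState.q_p (a := a ^ 8) _ (conj_eq hw)
    exact ⟨_, _, _, ⟨hq0 w hw, hlinq w hw, h1⟩, hp9 _ (conj_eq hw),
      .q_nine _ (conj_eq hw), h2⟩

end Steps
-- Values and valuations of roots of polynomials at a place.
section Roots

variable {K F : Type*} [Field K] [Field F] [Algebra K F] {V : ValuationSubring F}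

/-- A root of a monic polynomial with integral coefficients is integral, and its residue class is a
root of the reduction. -/
theorem mem_and_valuation_aeval_lt_one {f : F[X]} (hf : f.Monic) (g : K[X])
    (hfg : ∀ i, TakesValue V (f.coeff i) (g.coeff i)) {y : F} (hy : f.IsRoot y) :
    y ∈ V ∧ V.valuation (aeval y g) < 1 := by
  have hyV : y ∈ V := by
    obtain ⟨f', hf', -, hfm⟩ := lifts_and_natDegree_eq_and_monic (f := algebraMap V F) (p := f)
      ((lifts_iff_coeff_lifts _).2 fun i => ⟨⟨_, (hfg i).mem⟩, rfl⟩) hf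
    have hint : IsIntegral V y := ⟨f', hfm, by rw [← eval_map, hf']; exact hy⟩
    obtain ⟨y', hy'⟩ := IsIntegrallyClosed.isIntegral_iff.1 hint
    rw [← hy']
    exact y'.2
  refine ⟨hyV, ?_⟩
  have h1 : aeval y g = eval y (g.map (algebraMap K F) - f) := by
    rw [eval_sub, IsRoot.def.1 hy, sub_zero, eval_map_algebraMap]
  rw [h1, eval_eq_sum_range]
  refine valuation_sum_lt_one _ _ _ fun i _ => ?_
  rw [map_mul, coeff_sub, coeff_map, Valuation.map_sub_swap]
  exact mul_lt_one_of_lt_of_le (hfg i).lt_one ((V.valuation_le_one_iff _).2 (pow_mem hyV i))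

theorem coeff_quadratic {R : Type*} [CommRing R] (b c : R) (i : ℕ) :
    (X ^ 2 + C b * X + C c : R[X]).coeff i =
      if i = 0 then c else if i = 1 then b else if i = 2 then 1 else 0 := by
  rcases i with _ | _ | _ | i <;> simp [coeff_X, coeff_C, coeff_X_pow]

theorem coeff_cubic {R : Type*} [CommRing R] (b c d : R) (i : ℕ) :
    (X ^ 3 + C b * X ^ 2 + C c * X + C d : R[X]).coeff i =
      if i = 0 then d else if i = 1 then c else if i = 2 then b else if i = 3 then 1 else 0 := by
  rcases i with _ | _ | _ | _ | i <;> simp [coeff_X, coeff_C, coeff_X_pow]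

theorem monic_quadratic {R : Type*} [CommRing R] (b c : R) :
    (X ^ 2 + C b * X + C c : R[X]).Monic := by
  monicity!

theorem monic_cubic {R : Type*} [CommRing R] (b c d : R) :
    (X ^ 3 + C b * X ^ 2 + C c * X + C d : R[X]).Monic := by
  monicity!

theorem takesValue_coeff_quadratic {b c : F} {b' c' : K} (hb : TakesValue V b b')
    (hc : TakesValue V c c') (i : ℕ) :
    TakesValue V ((X ^ 2 + C b * X + C c : F[X]).coeff i)
      ((X ^ 2 + C b' * X + C c' : K[X]).coeff i) := by
  have h0 : TakesValue V (0 : F) (0 : K) := by simpa using TakesValue.const hb.const_mem (0 : K)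
  have h1 : TakesValue V (1 : F) (1 : K) := by simpa using TakesValue.const hb.const_mem (1 : K)
  rw [coeff_quadratic, coeff_quadratic]
  split_ifs <;> assumption

theorem takesValue_coeff_cubic {b c d : F} {b' c' d' : K} (hb : TakesValue V b b')
    (hc : TakesValue V c c') (hd : TakesValue V d d') (i : ℕ) :
    TakesValue V ((X ^ 3 + C b * X ^ 2 + C c * X + C d : F[X]).coeff i)
      ((X ^ 3 + C b' * X ^ 2 + C c' * X + C d' : K[X]).coeff i) := by
  have h0 : TakesValue V (0 : F) (0 : K) := by simpa using TakesValue.const hb.const_mem (0 : K)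
  have h1 : TakesValue V (1 : F) (1 : K) := by simpa using TakesValue.const hb.const_mem (1 : K)
  rw [coeff_cubic, coeff_cubic]
  split_ifs <;> assumption

theorem takesValue_of_quadratic_root [CharP F 2] {b c z : F} {s t : K}
    (hb : TakesValue V b (s + t)) (hc : TakesValue V c (s * t)) (hz : z ^ 2 + b * z + c = 0) :
    TakesValue V z s ∨ TakesValue V z t := by
  obtain ⟨hzV, hlt⟩ := mem_and_valuation_aeval_lt_one (monic_quadratic b c) _
    (takesValue_coeff_quadratic hb hc) (y := z) (by simpa [IsRoot.def] using hz)
  have e : aeval z (X ^ 2 + C (s + t) * X + C (s * t) : K[X]) =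
      (z - algebraMap K F s) * (z - algebraMap K F t) := by
    simp only [map_add, map_mul, map_pow, aeval_X, aeval_C]
    linear_combination (algebraMap K F s + algebraMap K F t) * z *
      (CharTwo.two_eq_zero : (2 : F) = 0)
  rw [e, map_mul] at hlt
  by_contra! H
  have h1 : 1 ≤ V.valuation (z - algebraMap K F s) :=
    not_lt.1 fun h => H.1 ⟨hb.const_mem, h⟩
  have h2 : 1 ≤ V.valuation (z - algebraMap K F t) :=
    not_lt.1 fun h => H.2 ⟨hb.const_mem, h⟩
  exact absurd hlt (not_lt.2 (one_le_mul h1 h2))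

theorem eval_Phi_of_splits [CharP K 2] [CharP F 2] {a x r s t : K} (h : PhiSplits a x r s t)
    (y : F) :
    (Phi (algebraMap K F a) (algebraMap K F x)).eval y = algebraMap K F (phi₃ a x) *
      ((y - algebraMap K F r) * (y - algebraMap K F s) * (y - algebraMap K F t)) := by
  have h2 : (2 : F) = 0 := CharTwo.two_eq_zero
  rw [eval_Phi, ← map_phi₃, ← map_phi₂, ← map_phi₁, ← map_phi₀, h.two, h.one, h.zero]
  simp only [map_add, map_mul]
  generalize algebraMap K F r = r'
  generalize algebraMap K F s = s'
  generalize algebraMap K F t = t'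
  linear_combination algebraMap K F (phi₃ a x) * (y ^ 2 * (r' + s' + t') + r' * s' * t') * h2

/-- The values of `y` at a place where `x` takes the value `c`, if `Φ(a, x, y) = 0`. -/
theorem takesValue_of_Phi_root [CharP K 2] [CharP F 2] {a c r s t : K} {x y : F}
    (h : PhiSplits a c r s t) (hx : TakesValue V x c)
    (hy : (Phi (algebraMap K F a) x).IsRoot y) :
    TakesValue V y r ∨ TakesValue V y s ∨ TakesValue V y t := by
  have h3 := hx.phi₃ a
  have h30 := h3.ne_zero h.ne_zero
  have hb := (hx.phi₂ a).div h3 h.ne_zero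
  have hc := (hx.phi₁ a).div h3 h.ne_zero
  have hd := (hx.phi₀ a).div h3 h.ne_zero
  rw [h.two, mul_div_cancel_left₀ _ h.ne_zero] at hb
  rw [h.one, mul_div_cancel_left₀ _ h.ne_zero] at hc
  rw [h.zero, mul_div_cancel_left₀ _ h.ne_zero] at hd
  rw [IsRoot.def, eval_Phi] at hy
  obtain ⟨hyV, hlt⟩ := mem_and_valuation_aeval_lt_one (monic_cubic _ _ _) _
    (takesValue_coeff_cubic hb hc hd) (y := y) (by
      simp only [IsRoot.def, eval_add, eval_mul, eval_pow, eval_X, eval_C]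
      field_simp
      linear_combination hy)
  have e : aeval y (X ^ 3 + C (r + s + t) * X ^ 2 + C (r * s + r * t + s * t) * X +
      C (r * s * t) : K[X]) =
      (y - algebraMap K F r) * (y - algebraMap K F s) * (y - algebraMap K F t) := by
    simp only [map_add, map_mul, map_pow, aeval_X, aeval_C]
    linear_combination ((algebraMap K F r + algebraMap K F s + algebraMap K F t) * y ^ 2 +
      algebraMap K F r * algebraMap K F s * algebraMap K F t) *
      (CharTwo.two_eq_zero : (2 : F) = 0)
  rw [e, map_mul, map_mul] at hlt
  by_contra! H
  have h1 : 1 ≤ V.valuation (y - algebraMap K F r) :=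
    not_lt.1 fun h => H.1 ⟨hx.const_mem, h⟩
  have h2 : 1 ≤ V.valuation (y - algebraMap K F s) :=
    not_lt.1 fun h => H.2.1 ⟨hx.const_mem, h⟩
  have h3 : 1 ≤ V.valuation (y - algebraMap K F t) :=
    not_lt.1 fun h => H.2.2 ⟨hx.const_mem, h⟩
  exact absurd hlt (not_lt.2 (one_le_mul (one_le_mul h1 h2) h3))

/-- The valuation of `x - c` in terms of that of `y`, at a smooth point of `Φ(a, x, y) = 0`. -/
theorem valuation_sub_eq [CharP K 2] [CharP F 2] {a c r s t d : K} {x y : F}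
    (h : PhiSplits a c r s t) (hx : TakesValue V x c) (hy : TakesValue V y d)
    (hxy : (Phi (algebraMap K F a) x).IsRoot y) (hq : phiQuot a c c d ≠ 0) :
    V.valuation (x - algebraMap K F c) = V.valuation (y - algebraMap K F r) *
      V.valuation (y - algebraMap K F s) * V.valuation (y - algebraMap K F t) := by
  have h1 := eval_Phi_sub (algebraMap K F a) x (algebraMap K F c) y
  rw [IsRoot.def.1 hxy, zero_sub, eval_Phi_of_splits h] at h1
  have h2 := congrArg V.valuation h1
  rw [Valuation.map_neg, map_mul, map_mul (V.valuation) (x - _),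
    TakesValue.valuation_const hx.const_mem h.ne_zero, one_mul, map_mul, map_mul,
    (hx.phiQuot hy a).valuation_eq_one hq, mul_one] at h2
  exact h2.symm

end Roots

/-! ### Extending places to roots of the quadratic and cubic polynomials. -/

section SimpleExtensions

variable {K E L : Type*} [Field K] [Field E] [Field L] [Algebra K E] [Algebra K L] [Algebra E L]
  [IsScalarTower K E L]

theorem minpoly_eq_quadratic {b c : E} {w : L}
    (hw : w ^ 2 + algebraMap E L b * w + algebraMap E L c = 0)
    (hwE : w ∉ (algebraMap E L).range) : minpoly E w = X ^ 2 + C b * X + C c := by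
  have hm := monic_quadratic b c
  have h0 : aeval w (X ^ 2 + C b * X + C c) = 0 := by simpa using hw
  have hint : IsIntegral E w := ⟨_, hm, h0⟩
  refine (eq_of_monic_of_dvd_of_natDegree_le (minpoly.monic hint) hm (minpoly.dvd E w h0) ?_).symm
  have h1 : (X ^ 2 + C b * X + C c : E[X]).natDegree = 2 := by compute_degree!
  rw [h1]
  have h2 := minpoly.natDegree_pos hint
  have h3 : (minpoly E w).natDegree ≠ 1 := fun h => hwE (minpoly.natDegree_eq_one_iff.1 h)
  omega

variable [CharP K 2]

theorem exists_extension_quadratic {A : ValuationSubring E} {b c : E} {w : L} {s t : K}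
    (hw : w ^ 2 + algebraMap E L b * w + algebraMap E L c = 0)
    (hwE : w ∉ (algebraMap E L).range) (hb : TakesValue A b (s + t))
    (hc : TakesValue A c (s * t)) :
    ∃ V : ValuationSubring L, V.comap (algebraMap E L) = A ∧ TakesValue V w s := by
  have hmin := minpoly_eq_quadratic hw hwE
  have hint : IsIntegral E w := ⟨_, monic_quadratic b c, by simpa using hw⟩
  refine exists_extension_takesValue A hb.const_mem hint (X ^ 2 + C (s + t) * X + C (s * t)) ?_ ?_
  · rw [hmin]
    exact takesValue_coeff_quadratic hb hc
  · simp only [eval_add, eval_mul, eval_pow, eval_X, eval_C]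
    linear_combination (s ^ 2 + s * t) * (CharTwo.two_eq_zero : (2 : K) = 0)

theorem exists_extension_cubic {A : ValuationSubring E} {x : E} {w : L} {a c r s t : K}
    (hint : IsIntegral E w)
    (hmin : minpoly E w = X ^ 3 + C (phi₂ (algebraMap K E a) x / phi₃ (algebraMap K E a) x) * X ^ 2 +
      C (phi₁ (algebraMap K E a) x / phi₃ (algebraMap K E a) x) * X +
      C (phi₀ (algebraMap K E a) x / phi₃ (algebraMap K E a) x))
    (h : PhiSplits a c r s t) (hx : TakesValue A x c) :
    ∃ V : ValuationSubring L, V.comap (algebraMap E L) = A ∧ TakesValue V w r := by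
  have h3 := hx.phi₃ a
  have hb := (hx.phi₂ a).div h3 h.ne_zero
  have hc := (hx.phi₁ a).div h3 h.ne_zero
  have hd := (hx.phi₀ a).div h3 h.ne_zero
  rw [h.two, mul_div_cancel_left₀ _ h.ne_zero] at hb
  rw [h.one, mul_div_cancel_left₀ _ h.ne_zero] at hc
  rw [h.zero, mul_div_cancel_left₀ _ h.ne_zero] at hd
  refine exists_extension_takesValue A hx.const_mem hint (X ^ 3 + C (r + s + t) * X ^ 2 +
    C (r * s + r * t + s * t) * X + C (r * s * t)) ?_ ?_
  · rw [hmin]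
    exact takesValue_coeff_cubic hb hc hd
  · simp only [eval_add, eval_mul, eval_pow, eval_X, eval_C]
    linear_combination (r ^ 3 + r ^ 2 * s + r ^ 2 * t + r * s * t) *
      (CharTwo.two_eq_zero : (2 : K) = 0)

end SimpleExtensions

/-! ### Degrees in the tower, from ramification above `α²⁶` and `α²⁸`. -/

section Degrees

variable {K Ω : Type*} [Field K] [Field Ω] [Algebra K Ω]

/-- The condition `hfin` excludes the convention that an infinite relative degree is zero. -/
theorem le_relfinrank_of_linearIndependent {E E' : IntermediateField K Ω} (h : E ≤ E')
    (hfin : IntermediateField.relfinrank E E' ≠ 0) {π : Ω} (hπ : π ∈ E') {e : ℕ}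
    (hli : LinearIndependent E fun i : Fin e => π ^ (i : ℕ)) :
    e ≤ IntermediateField.relfinrank E E' := by
  rw [IntermediateField.relfinrank_eq_finrank_of_le h] at hfin ⊢
  have : FiniteDimensional E (IntermediateField.extendScalars h) :=
    Module.finite_of_finrank_pos (Nat.pos_of_ne_zero hfin)
  let π' : IntermediateField.extendScalars h := ⟨π, hπ⟩
  have hli' : LinearIndependent E fun i : Fin e => π' ^ (i : ℕ) := by
    refine LinearIndependent.of_comp (IntermediateField.extendScalars h).val.toLinearMap ?_
    have e : (IntermediateField.extendScalars h).val.toLinearMap ∘ (fun i : Fin e => π' ^ (i : ℕ)) =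
        fun i : Fin e => π ^ (i : ℕ) := by
      ext i
      simp [π']
    rw [e]
    exact hli
  simpa using hli'.fintype_card_le_finrank

variable {u : ℕ → Ω}

theorem towerField_zero : towerField K u 0 = IntermediateField.adjoin K {u 0} := by
  have : u '' Set.Iic 0 = {u 0} := by ext; simp [eq_comm]
  rw [towerField, this]

theorem mem_towerField {i n : ℕ} (h : i ≤ n) : u i ∈ towerField K u n :=
  (towerGen K u h).2

theorem extendScalars_towerField_succ (n : ℕ) :
    IntermediateField.extendScalars (towerField_mono K u (Nat.le_succ n)) =
      IntermediateField.adjoin (towerField K u n) {u (n + 1)} := by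
  refine le_antisymm ?_ ?_
  · rw [IntermediateField.extendScalars_le_iff, towerField, IntermediateField.adjoin_le_iff]
    rintro _ ⟨i, hi, rfl⟩
    change u i ∈ IntermediateField.adjoin (towerField K u n) {u (n + 1)}
    rcases Nat.le_succ_iff.1 hi with h | h
    · exact (IntermediateField.adjoin (towerField K u n) {u (n + 1)}).algebraMap_mem
        (towerGen K u h)
    · rw [h]
      exact IntermediateField.mem_adjoin_simple_self (towerField K u n) (u (n + 1))
  · rw [IntermediateField.adjoin_le_iff, Set.singleton_subset_iff,
      SetLike.mem_coe, IntermediateField.mem_extendScalars]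
    exact mem_towerField (le_refl (n + 1))

theorem relfinrank_towerField_succ {n : ℕ} (h : IsIntegral (towerField K u n) (u (n + 1))) :
    IntermediateField.relfinrank (towerField K u n) (towerField K u (n + 1)) =
      (minpoly (towerField K u n) (u (n + 1))).natDegree := by
  rw [IntermediateField.relfinrank_eq_finrank_of_le (towerField_mono K u (Nat.le_succ n)),
    extendScalars_towerField_succ, IntermediateField.adjoin.finrank h]

theorem linearIndependent_pow_towerField_zero (ht : Transcendental K (u 0))
    {V : ValuationSubring Ω} {c : K} (h : TakesValue V (u 0) c) {π : Ω} {e : ℕ}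
    (hπ : V.valuation π ^ e = V.valuation (u 0 - algebraMap K Ω c)) :
    LinearIndependent (towerField K u 0) fun i : Fin e => π ^ (i : ℕ) := by
  refine linearIndependent_pow_of_valuation (fun x hx => ?_) ?_ h.lt_one hπ
  · refine exists_valuation_eq_zpow h ht ?_ (by simpa using hx)
    rw [← towerField_zero]
    exact x.2
  · rw [Ne, map_eq_zero, sub_eq_zero]
    intro h0
    exact ht (h0 ▸ isAlgebraic_algebraMap c)

variable {α : K}

theorem algebraMap_twist {F : Type*} [Field F] [Algebra K F] {a : K}
    (ha : a ^ 5 + a ^ 2 + 1 = 0) :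
    algebraMap K F a ^ 5 + algebraMap K F a ^ 2 + 1 = 0 := by
  rw [← map_pow, ← map_pow, ← map_one (algebraMap K F), ← map_add, ← map_add, ha, map_zero]

variable [CharP K 2]

theorem phiQuot_twentysix_ne_zero {a : K} (ha : a ^ 5 + a ^ 2 + 1 = 0) :
    phiQuot a (a ^ 26) (a ^ 26) (a ^ 30) ≠ 0 := by
  simp only [phiQuot]
  grind

/-- A function with a nonzero value at some place is nonzero; the place `u₀ = α²⁶` serves as
witness. -/
theorem IsTowerSeq.phi₃_ne_zero (hα : α ^ 5 + α ^ 2 + 1 = 0) (hu : IsTowerSeq α u) :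
    phi₃ (algebraMap K Ω α) (u 0) ≠ 0 := by
  obtain ⟨V, hV⟩ := exists_takesValue_of_transcendental hu.transcendental (α ^ 26)
  exact (hV.phi₃ α).ne_zero (phiSplits_twentysix hα).ne_zero

theorem IsTowerSeq.aeval_cubic (hα : α ^ 5 + α ^ 2 + 1 = 0) (hu : IsTowerSeq α u)
    {E : Type*} [Field E] [Algebra K E] [Algebra E Ω] [IsScalarTower K E Ω] {x : E}
    (hx : algebraMap E Ω x = u 0) :
    aeval (u 1) (X ^ 3 + C (phi₂ (algebraMap K E α) x / phi₃ (algebraMap K E α) x) * X ^ 2 +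
      C (phi₁ (algebraMap K E α) x / phi₃ (algebraMap K E α) x) * X +
      C (phi₀ (algebraMap K E α) x / phi₃ (algebraMap K E α) x)) = 0 := by
  have h := hu.first
  have h3 := hu.phi₃_ne_zero hα
  rw [IsRoot.def, eval_Phi] at h
  simp only [map_add, map_mul, map_pow, aeval_X, aeval_C, map_div₀, map_phi₀, map_phi₁, map_phi₂,
    map_phi₃, hx, ← IsScalarTower.algebraMap_apply]
  field_simp
  linear_combination h

/-- The situation at the totally ramified place `V`. -/
structure CuspData (α : K) (u : ℕ → Ω) (V : ValuationSubring Ω) (n : ℕ) (x y r : K) : Prop where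
  state : CuspState (α ^ 8 ^ n) x y r
  left : TakesValue V (u n) x
  right : TakesValue V (u (n + 1)) y
  root : (Phi (algebraMap K Ω (α ^ 8 ^ n)) (u n)).IsRoot (u (n + 1))
  ramified : V.valuation (u (n + 1) - algebraMap K Ω y) ^ 2 = V.valuation (u n - algebraMap K Ω x)

theorem CuspData.ne_zero (hα : α ^ 5 + α ^ 2 + 1 = 0) {V : ValuationSubring Ω} {n : ℕ}
    {x y r : K} (h : CuspData α u V n x y r) :
    u n + algebraMap K Ω (α ^ 8 ^ n) ^ 25 ≠ 0 ∧
      phi₃ (algebraMap K Ω (α ^ 8 ^ n) ^ 8) (u (n + 1)) ≠ 0 := by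
  obtain ⟨s, r', -, hstep⟩ := h.state.step (twist_pow_eq hα n)
  constructor
  · have := h.left.add ((TakesValue.const h.left.const_mem (α ^ 8 ^ n)).pow 25)
    exact this.ne_zero hstep.ne_zero
  · have := (h.right.phi₃ ((α ^ 8 ^ n) ^ 8)).ne_zero hstep.splits.ne_zero
    rwa [map_pow] at this

variable [CharP Ω 2]

/-- Ramification of index three above `u₀ = α ^ 26`. -/
theorem takesValue_and_valuation_twentysix {F : Type*} [Field F] [Algebra K F] [CharP F 2]
    (hα : α ^ 5 + α ^ 2 + 1 = 0) {x y : F} (hxy : (Phi (algebraMap K F α) x).IsRoot y)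
    {V : ValuationSubring F} (h : TakesValue V x (α ^ 26)) :
    TakesValue V y (α ^ 30) ∧ V.valuation (y - algebraMap K F (α ^ 30)) ^ 3 =
      V.valuation (x - algebraMap K F (α ^ 26)) := by
  have hs := phiSplits_twentysix hα
  have h1 : TakesValue V y (α ^ 30) := by
    rcases takesValue_of_Phi_root hs h hxy with h | h | h <;> exact h
  refine ⟨h1, ?_⟩
  rw [valuation_sub_eq hs h h1 hxy (phiQuot_twentysix_ne_zero hα), pow_three, mul_assoc]

/-- Irreducibility of the cubic is a consequence of ramification: at a place above `α²⁶` the cube of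
`v(u₁ - α³⁰)` is `v(u₀ - α²⁶)`, so three powers of `u₁ - α³⁰` are independent over `F₀`. -/
theorem IsTowerSeq.minpoly_one (hα : α ^ 5 + α ^ 2 + 1 = 0) (hu : IsTowerSeq α u) :
    IsIntegral (towerField K u 0) (u 1) ∧
    IntermediateField.relfinrank (towerField K u 0) (towerField K u 1) = 3 ∧
    minpoly (towerField K u 0) (u 1) = X ^ 3 +
      C (phi₂ (algebraMap K _ α) (towerGen K u le_rfl) /
        phi₃ (algebraMap K _ α) (towerGen K u le_rfl)) * X ^ 2 +
      C (phi₁ (algebraMap K _ α) (towerGen K u le_rfl) /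
        phi₃ (algebraMap K _ α) (towerGen K u le_rfl)) * X +
      C (phi₀ (algebraMap K _ α) (towerGen K u le_rfl) /
        phi₃ (algebraMap K _ α) (towerGen K u le_rfl)) := by
  have h0 := hu.aeval_cubic hα (E := towerField K u 0) (x := towerGen K u le_rfl) rfl
  set f : (towerField K u 0)[X] := X ^ 3 +
      C (phi₂ (algebraMap K _ α) (towerGen K u le_rfl) /
        phi₃ (algebraMap K _ α) (towerGen K u le_rfl)) * X ^ 2 +
      C (phi₁ (algebraMap K _ α) (towerGen K u le_rfl) /
        phi₃ (algebraMap K _ α) (towerGen K u le_rfl)) * X +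
      C (phi₀ (algebraMap K _ α) (towerGen K u le_rfl) /
        phi₃ (algebraMap K _ α) (towerGen K u le_rfl)) with hf
  have hm : f.Monic := monic_cubic _ _ _
  have hint : IsIntegral (towerField K u 0) (u 1) := ⟨f, hm, h0⟩
  have hdeg : f.natDegree = 3 := by rw [hf]; compute_degree!
  have hdvd := minpoly.dvd _ _ h0
  have hle : (minpoly (towerField K u 0) (u 1)).natDegree ≤ 3 :=
    hdeg ▸ natDegree_le_of_dvd hdvd hm.ne_zero
  have hrel := relfinrank_towerField_succ (n := 0) hint
  have hpos := minpoly.natDegree_pos hint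
  obtain ⟨V, hV⟩ := exists_takesValue_of_transcendental hu.transcendental (α ^ 26)
  obtain ⟨h1, h2⟩ := takesValue_and_valuation_twentysix hα hu.first hV
  have hge := le_relfinrank_of_linearIndependent (towerField_mono K u (Nat.zero_le 1))
    (by rw [hrel]; exact hpos.ne')
    (sub_mem (mem_towerField le_rfl) ((towerField K u 1).algebraMap_mem (α ^ 30)))
    (linearIndependent_pow_towerField_zero hu.transcendental hV h2)
  have heq : (minpoly (towerField K u 0) (u 1)).natDegree = 3 := by
    rw [zero_add] at hrel
    omega
  refine ⟨hint, hrel.trans heq, ?_⟩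
  exact (eq_of_monic_of_dvd_of_natDegree_le (minpoly.monic hint) hm hdvd
    (by rw [hdeg, heq])).symm

/-- In the product formula of `valuation_sub_eq` the factor of the simple root `r` is a unit because
`y ≠ r`, leaving the double root. -/
theorem CuspState.valuation_sq {a : K} (ha : a ^ 5 + a ^ 2 + 1 = 0) {x y r : K}
    (h : CuspState a x y r) {V : ValuationSubring Ω} {s t : Ω} (hs : TakesValue V s x)
    (ht : TakesValue V t y) (hst : (Phi (algebraMap K Ω a) s).IsRoot t) :
    V.valuation (t - algebraMap K Ω y) ^ 2 = V.valuation (s - algebraMap K Ω x) := by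
  have hr : TakesValue V (t - algebraMap K Ω r) (y - r) :=
    ht.sub (TakesValue.const ht.const_mem r)
  rw [valuation_sub_eq (h.splits ha) hs ht hst (h.phiQuot_ne_zero ha),
    hr.valuation_eq_one (sub_ne_zero.2 (h.ne ha)), one_mul, sq]

theorem IsTowerSeq.exists_cuspData_zero (hα : α ^ 5 + α ^ 2 + 1 = 0) (hu : IsTowerSeq α u) :
    ∃ (V : ValuationSubring Ω) (x y r : K), CuspData α u V 0 x y r := by
  obtain ⟨W, hW⟩ := exists_takesValue_of_transcendental hu.transcendental (α ^ 28)
  obtain ⟨hint, -, hmin⟩ := hu.minpoly_one hα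
  have hst : CuspState α (α ^ 28) (α ^ 28) (α ^ 7) := .twentyeight
  have hA : TakesValue (W.comap ((towerField K u 0).val : towerField K u 0 →+* Ω))
      (towerGen K u le_rfl : towerField K u 0) (α ^ 28) := takesValue_comap.2 hW
  -- `rotate` selects the double root as the value of `u₁`. The extension is taken to all of `Ω`, so
  -- that `V` restricts to every level of the tower.
  obtain ⟨V, hVA, hV1⟩ := exists_extension_cubic hint hmin (hst.splits hα).rotate hA
  have hV0 : TakesValue V (u 0) (α ^ 28) := by
    rw [← hVA] at hA
    exact takesValue_comap (f := (towerField K u 0).val).1 hA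
  have e : α ^ 8 ^ 0 = α := by simp
  refine ⟨V, α ^ 28, α ^ 28, α ^ 7, ?_, hV0, hV1, ?_, hst.valuation_sq hα hV0 hV1 hu.first⟩
  · rw [e]; exact hst
  · rw [e]; exact hu.first

theorem CuspData.quad_root (hα : α ^ 5 + α ^ 2 + 1 = 0) (hu : IsTowerSeq α u)
    {V : ValuationSubring Ω} {n : ℕ} {x y r : K} (h : CuspData α u V n x y r) :
    u (n + 2) ^ 2 + quadB (algebraMap K Ω (α ^ 8 ^ n)) (u n) (u (n + 1)) * u (n + 2) +
      quadC (algebraMap K Ω (α ^ 8 ^ n)) (u n) (u (n + 1)) = 0 := by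
  obtain ⟨h1, h2⟩ := h.ne_zero hα
  have h3 := hu.next n
  rw [← map_pow] at h3
  exact (quadFactor_isRoot_iff (algebraMap_twist (twist_pow_eq hα n)) h.root h1 h2 _).1 h3

/-- The quadratic reduces to a square, so the value of the next generator at the same `V` is forced
and no new extension has to be chosen. -/
theorem CuspData.succ (hα : α ^ 5 + α ^ 2 + 1 = 0) (hu : IsTowerSeq α u)
    {V : ValuationSubring Ω} {n : ℕ} {x y r : K} (h : CuspData α u V n x y r) :
    ∃ z r', CuspData α u V (n + 1) y z r' := by
  have ha := twist_pow_eq hα n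
  obtain ⟨s, r', hst, hstep⟩ := h.state.step ha
  obtain ⟨h1, h2⟩ := h.ne_zero hα
  have hq := h.quad_root hα hu
  have hB := h.left.quadB h.right hstep.ne_zero hstep.splits.ne_zero
  have hC := h.left.quadC h.right hstep.ne_zero hstep.splits.ne_zero
  rw [hstep.quadB_eq] at hB
  rw [hstep.quadC_eq] at hC
  have hz : TakesValue V (u (n + 2)) s := by
    rcases takesValue_of_quadratic_root hB hC hq with h | h <;> exact h
  have hroot := Phi_isRoot_of_quad (algebraMap_twist ha) h.root h1 h2 hq
  have e : (α ^ 8 ^ n) ^ 8 = α ^ 8 ^ (n + 1) := by rw [← pow_mul, ← pow_succ]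
  rw [← map_pow, e] at hroot
  rw [e] at hst
  exact ⟨s, r', hst, h.right, hz, hroot,
    hst.valuation_sq (twist_pow_eq hα (n + 1)) h.right hz hroot⟩

theorem IsTowerSeq.exists_cuspData (hα : α ^ 5 + α ^ 2 + 1 = 0) (hu : IsTowerSeq α u) :
    ∃ (V : ValuationSubring Ω) (c : K), TakesValue V (u 0) c ∧ ∀ n, ∃ x y r : K,
      CuspData α u V n x y r ∧ V.valuation (u (n + 1) - algebraMap K Ω y) ^ 2 ^ (n + 1) =
        V.valuation (u 0 - algebraMap K Ω c) := by
  obtain ⟨V, x, y, r, h⟩ := hu.exists_cuspData_zero hα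
  refine ⟨V, x, h.left, fun n => ?_⟩
  induction n with
  | zero => exact ⟨x, y, r, h, by simpa using h.ramified⟩
  | succ n ih =>
    obtain ⟨x', y', r', h', hv⟩ := ih
    obtain ⟨z, r'', h''⟩ := h'.succ hα hu
    refine ⟨y', z, r'', h'', ?_⟩
    rw [← hv, ← h''.ramified, ← pow_mul]
    congr 1
    ring

/-- A relation between functions, read off from the data at `V`: the place is needed only to know
that the division by the linear factor is legitimate at each level. -/
theorem IsTowerSeq.Phi_root (hα : α ^ 5 + α ^ 2 + 1 = 0) (hu : IsTowerSeq α u) (n : ℕ) :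
    (Phi (algebraMap K Ω (α ^ 8 ^ n)) (u n)).IsRoot (u (n + 1)) := by
  obtain ⟨V, c, -, h⟩ := hu.exists_cuspData hα
  obtain ⟨x, y, r, h, -⟩ := h n
  exact h.root

theorem IsTowerSeq.quad_root (hα : α ^ 5 + α ^ 2 + 1 = 0) (hu : IsTowerSeq α u) (n : ℕ) :
    u (n + 2) ^ 2 + quadB (algebraMap K Ω (α ^ 8 ^ n)) (u n) (u (n + 1)) * u (n + 2) +
      quadC (algebraMap K Ω (α ^ 8 ^ n)) (u n) (u (n + 1)) = 0 := by
  obtain ⟨V, c, -, h⟩ := hu.exists_cuspData hα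
  obtain ⟨x, y, r, h, -⟩ := h n
  exact h.quad_root hα hu

theorem IsTowerSeq.aeval_quad (hα : α ^ 5 + α ^ 2 + 1 = 0) (hu : IsTowerSeq α u) (n : ℕ) :
    u (n + 2) ^ 2 + algebraMap (towerField K u (n + 1)) Ω (quadB (algebraMap K _ (α ^ 8 ^ n))
        (towerGen K u (Nat.le_succ n)) (towerGen K u le_rfl)) * u (n + 2) +
      algebraMap (towerField K u (n + 1)) Ω (quadC (algebraMap K _ (α ^ 8 ^ n))
        (towerGen K u (Nat.le_succ n)) (towerGen K u le_rfl)) = 0 := by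
  rw [map_quadB, map_quadC]
  exact hu.quad_root hα n

theorem IsTowerSeq.isIntegral (hα : α ^ 5 + α ^ 2 + 1 = 0) (hu : IsTowerSeq α u) (n : ℕ) :
    IsIntegral (towerField K u (n + 1)) (u (n + 2)) :=
  ⟨_, monic_quadratic _ _, by simpa using hu.aeval_quad hα n⟩

/-- The two claims are interlaced: the degree at one level, compared with the ramification index at
`V`, shows that the next generator is new, and then the quadratic doubles the degree. -/
theorem IsTowerSeq.degrees (hα : α ^ 5 + α ^ 2 + 1 = 0) (hu : IsTowerSeq α u) (n : ℕ) :
    IntermediateField.relfinrank (towerField K u 0) (towerField K u (n + 1)) = 3 * 2 ^ n ∧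
      u (n + 2) ∉ (algebraMap (towerField K u (n + 1)) Ω).range := by
  obtain ⟨V, c, hc, h⟩ := hu.exists_cuspData hα
  have key : ∀ n, IntermediateField.relfinrank (towerField K u 0) (towerField K u (n + 1)) =
      3 * 2 ^ n → u (n + 2) ∉ (algebraMap (towerField K u (n + 1)) Ω).range := by
    rintro n hn ⟨z, hz⟩
    obtain ⟨x, y, r, -, hv⟩ := h (n + 1)
    have hge := le_relfinrank_of_linearIndependent (towerField_mono K u (Nat.zero_le (n + 1)))
      (by rw [hn]; positivity)
      (sub_mem (hz ▸ z.2 : u (n + 2) ∈ towerField K u (n + 1))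
        ((towerField K u (n + 1)).algebraMap_mem y))
      (linearIndependent_pow_towerField_zero hu.transcendental hc hv)
    -- If `uₙ₊₂` were in `Fₙ₊₁`, there would be `2ⁿ⁺² = 4 · 2ⁿ` independent powers in a space of
    -- dimension `3 · 2ⁿ`.
    rw [hn, pow_succ, pow_succ] at hge
    have : 0 < 2 ^ n := by positivity
    omega
  have hdeg : ∀ n,
      IntermediateField.relfinrank (towerField K u 0) (towerField K u (n + 1)) = 3 * 2 ^ n := by
    intro n
    induction n with
    | zero => simpa using (hu.minpoly_one hα).2.1
    | succ n ih =>
      have hmin := minpoly_eq_quadratic (hu.aeval_quad hα n) (key n ih)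
      have h2 := relfinrank_towerField_succ (hu.isIntegral hα n)
      rw [hmin] at h2
      have h3 : ∀ b c : towerField K u (n + 1), (X ^ 2 + C b * X + C c).natDegree = 2 := by
        intro b c; compute_degree!
      rw [h3] at h2
      rw [← IntermediateField.relfinrank_mul_relfinrank
        (towerField_mono K u (Nat.zero_le (n + 1))) (towerField_mono K u (Nat.le_succ (n + 1))),
        ih, h2]
      ring
  exact ⟨hdeg n, key n (hdeg n)⟩

end Degrees

/-! ### Local analysis at the exceptional state `(a²⁷, a²²)`. -/

section ExceptionalStep

variable {K E : Type*} [Field K] [Field E] [Algebra K E]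

theorem TakesValue.zero_mul {A : ValuationSubring E} {x y : E} (hx : TakesValue A x (0 : K))
    (hy : y ∈ A) : TakesValue A (x * y) (0 : K) := by
  rw [TakesValue.zero_iff hx.const_mem, map_mul]
  exact mul_lt_one_of_lt_of_le ((TakesValue.zero_iff hx.const_mem).1 hx) ((A.valuation_le_one_iff _).2 hy)

variable [CharP E 2]

/-- Expansion of the Möbius function `linRoot` at `x = b²⁷`. Its slope there becomes the constant
`m` of the separable quadratic. -/
theorem linRoot_eq_add {b x : E} (hb : b ^ 5 + b ^ 2 + 1 = 0) (hx : x + b ^ 25 ≠ 0) :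
    linRoot b x = b ^ 23 + (x + b ^ 27) * ((b ^ 28 + b ^ 23) / (x + b ^ 25)) := by
  rw [linRoot, div_eq_iff hx, add_mul, mul_assoc, div_mul_cancel₀ _ hx]
  clear hx
  grind

variable [CharP K 2] {a : K}

/-- Above the point `(a²⁷, a²²)`, the function `y - a²²` is divisible by `(x - a²⁷)³`. -/
theorem exists_eq_pow_three_mul (ha : a ^ 5 + a ^ 2 + 1 = 0) {A : ValuationSubring E} {x y : E}
    (hxy : (Phi (algebraMap K E a) x).IsRoot y) (hx : TakesValue A x (a ^ 27))
    (hy : TakesValue A y (a ^ 22)) :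
    ∃ τ ∈ A, y + algebraMap K E (a ^ 22) = (x + algebraMap K E (a ^ 27)) ^ 3 * τ := by
  have h2 : (2 : E) = 0 := CharTwo.two_eq_zero
  have ha' : algebraMap K E a ^ 5 + algebraMap K E a ^ 2 + 1 = 0 := algebraMap_twist ha
  have hk := TakesValue.const hx.const_mem (a ^ 22)
  set k : E := algebraMap K E (a ^ 22) with hkdef
  have hG := (((hx.phi₃ a).mul (((hy.pow 2).add (hy.mul hk)).add (hk.pow 2))).add
    ((hx.phi₂ a).mul (hy.add hk))).add (hx.phi₁ a)
  -- `G` is the difference quotient of `Φ(a, x, T)` in `T` between `y` and `k`. It is a unit at `A`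
  -- because `a²²` is a simple root of `Φ(a, a²⁷, T)`.
  set G := phi₃ (algebraMap K E a) x * (y ^ 2 + y * k + k ^ 2) +
    phi₂ (algebraMap K E a) x * (y + k) + phi₁ (algebraMap K E a) x with hGdef
  have hG0 : phi₃ a (a ^ 27) * ((a ^ 22) ^ 2 + a ^ 22 * a ^ 22 + (a ^ 22) ^ 2) +
      phi₂ a (a ^ 27) * (a ^ 22 + a ^ 22) + phi₁ a (a ^ 27) ≠ 0 := by
    simp only [phi₁, phi₂, phi₃]
    grind
  have hG1 := hG.valuation_eq_one hG0
  have hGne := hG.ne_zero hG0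
  -- As a cubic in `x`, `Φ(a, x, a²²)` is its leading coefficient times an exact cube.
  have hcube : phi₃ (algebraMap K E a) x * k ^ 3 + phi₂ (algebraMap K E a) x * k ^ 2 +
      phi₁ (algebraMap K E a) x * k + phi₀ (algebraMap K E a) x =
      algebraMap K E ((a ^ 22) ^ 3 + a ^ 17 * (a ^ 22) ^ 2 + a ^ 30 * a ^ 22 + a ^ 4) *
        (x + algebraMap K E (a ^ 27)) ^ 3 := by
    simp only [hkdef, phi₀, phi₁, phi₂, phi₃, map_add, map_mul, map_pow]
    generalize algebraMap K E a = b at ha'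
    grind
  rw [IsRoot.def, eval_Phi] at hxy
  refine ⟨algebraMap K E ((a ^ 22) ^ 3 + a ^ 17 * (a ^ 22) ^ 2 + a ^ 30 * a ^ 22 + a ^ 4) * G⁻¹,
    A.mul_mem _ _ (hx.const_mem _) ?_, ?_⟩
  · rw [← A.valuation_le_one_iff, map_inv₀, hG1, inv_one]
  · rw [← mul_assoc, eq_mul_inv_iff_mul_eq₀ hGne, mul_comm _ (algebraMap K E _), ← hcube, hGdef]
    linear_combination hxy + (phi₃ (algebraMap K E a) x * (y ^ 2 * k + y * k ^ 2) +
      phi₂ (algebraMap K E a) x * y * k - phi₀ (algebraMap K E a) x) * h2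

/-- At the point `(a²⁷, a²²)` the quadratic factor becomes separable after the substitution
`z = a²³ + (x - a²⁷) w`. -/
theorem exists_quadratic_substitution (ha : a ^ 5 + a ^ 2 + 1 = 0) {A : ValuationSubring E}
    {x y : E} (hxy : (Phi (algebraMap K E a) x).IsRoot y) (hx : TakesValue A x (a ^ 27))
    (hy : TakesValue A y (a ^ 22)) (hx0 : x ≠ algebraMap K E (a ^ 27)) :
    ∃ (b c : E) (m : K), m ≠ 0 ∧ TakesValue A b m ∧ TakesValue A c (m ^ 2) ∧
      quadB (algebraMap K E a) x y = (x + algebraMap K E (a ^ 27)) * b ∧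
      algebraMap K E (a ^ 23) ^ 2 + quadB (algebraMap K E a) x y * algebraMap K E (a ^ 23) +
        quadC (algebraMap K E a) x y = (x + algebraMap K E (a ^ 27)) ^ 2 * c := by
  have h2 : (2 : E) = 0 := CharTwo.two_eq_zero
  have ha' : algebraMap K E a ^ 5 + algebraMap K E a ^ 2 + 1 = 0 := algebraMap_twist ha
  obtain ⟨τ, hτ, hY⟩ := exists_eq_pow_three_mul ha hxy hx hy
  have hsp := phiSplits_twentysix (twist_eq ha)
  rw [← pow_eq_twist_pow ha (m := 22) (n := 26) (by norm_num),
    ← pow_eq_twist_pow ha (m := 23) (n := 30) (by norm_num)] at hsp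
  set P := x + algebraMap K E (a ^ 27) with hP
  have hP0 : P ≠ 0 := by
    rw [hP, Ne, CharTwo.add_eq_zero]
    exact hx0
  have hPv : TakesValue A P (0 : K) := by
    have := hx.add (TakesValue.const hx.const_mem (a ^ 27))
    rwa [CharTwo.add_self_eq_zero] at this
  set r := algebraMap K E (a ^ 23) with hr
  have hrA : r ∈ A := hx.const_mem _
  set k := algebraMap K E (a ^ 22) with hk
  have hkA : k ∈ A := hx.const_mem _
  have hyA := hy.mem
  set e := algebraMap K E (a ^ 8) with he
  have heA : e ∈ A := hx.const_mem _
  have hL3 := hy.phi₃ (a ^ 8)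
  rw [← he] at hL3
  set L3 := phi₃ e y with hL3def
  have hL3v := hL3.valuation_eq_one hsp.ne_zero
  have hL3ne := hL3.ne_zero hsp.ne_zero
  have hL3A : L3⁻¹ ∈ A := by rw [← A.valuation_le_one_iff, map_inv₀, hL3v, inv_one]
  let d3 := y ^ 2 + y * k + k ^ 2 + e ^ 24 * (y + k) + e ^ 4
  let d2 := e ^ 17 * (y ^ 2 + y * k + k ^ 2) + e ^ 29 * (y + k) + 1
  let d1 := e ^ 30 * (y ^ 2 + y * k + k ^ 2) + e ^ 12 * (y + k) + e ^ 30
  have hd3 : d3 ∈ A := by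
    apply_rules [add_mem, mul_mem, pow_mem, one_mem]
  have hd2 : d2 ∈ A := by
    apply_rules [add_mem, mul_mem, pow_mem, one_mem]
  have hd1 : d1 ∈ A := by
    apply_rules [add_mem, mul_mem, pow_mem, one_mem]
  have hk2 : phi₂ e k = phi₃ e k * (r + r + r) := by
    have := congrArg (algebraMap K E) hsp.two
    simpa only [map_mul, map_add, map_phi₂, map_phi₃] using this
  have hk1 : phi₁ e k = phi₃ e k * (r * r + r * r + r * r) := by
    have := congrArg (algebraMap K E) hsp.one
    simpa only [map_mul, map_add, map_phi₁, map_phi₃] using this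
  -- At `y = k` the triple root gives `φ₂/φ₃ = r` and `φ₁/φ₃ = r²`. Since `y - k` is divisible by
  -- `P³`, these hold at `y` up to order three in `P`, whereas `linRoot` differs from `r` already in
  -- order one.
  have e2 : phi₂ e y = r * L3 + P ^ 3 * τ * (d2 + r * d3) := by
    rw [← hY]
    have h3 : phi₃ e y - phi₃ e k = (y - k) * d3 := by simp only [phi₃, d3]; ring
    have h4 : phi₂ e y - phi₂ e k = (y - k) * d2 := by simp only [phi₂, d2]; ring
    linear_combination h4 + r * h3 + hk2 +
      (2 * r * phi₃ e k - r * L3 - k * (d2 + r * d3)) * h2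
  have e1 : phi₁ e y = r ^ 2 * L3 + P ^ 3 * τ * (d1 + r ^ 2 * d3) := by
    rw [← hY]
    have h3 : phi₃ e y - phi₃ e k = (y - k) * d3 := by simp only [phi₃, d3]; ring
    have h4 : phi₁ e y - phi₁ e k = (y - k) * d1 := by simp only [phi₁, d1]; ring
    linear_combination h4 + r ^ 2 * h3 + hk1 +
      (2 * r ^ 2 * phi₃ e k - r ^ 2 * L3 - k * (d1 + r ^ 2 * d3)) * h2
  set l := linRoot (algebraMap K E a) x with hl
  have hdne : a ^ 27 + a ^ 25 ≠ 0 := by grind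
  have hden := hx.add (TakesValue.const hx.const_mem (a ^ 25))
  have hden0 := hden.ne_zero hdne
  set μ := algebraMap K E (a ^ 28 + a ^ 23) / (x + algebraMap K E (a ^ 25)) with hμ
  have hμv : TakesValue A μ ((a ^ 28 + a ^ 23) / (a ^ 27 + a ^ 25)) :=
    (TakesValue.const hx.const_mem _).div hden hdne
  have hlμ : l = r + P * μ := by
    rw [map_pow] at hden0
    rw [hl, linRoot_eq_add ha' hden0, hμ, hP, hr]
    simp only [map_add, map_pow]
  set m : K := (a ^ 28 + a ^ 23) / (a ^ 27 + a ^ 25) with hm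
  have hm0 : m ≠ 0 := div_ne_zero (by grind) hdne
  have hBeq : quadB (algebraMap K E a) x y = P * (P * (P * τ * (d2 + r * d3) * L3⁻¹) + μ) := by
    rw [quadB, ← map_pow, ← he, ← hl, hlμ, e2, ← hL3def]
    field_simp
    linear_combination r * L3 * h2
  -- With `z = r + P w`, the linear coefficient is `P b` and the constant one is `P² c`; modulo `P`
  -- these are governed by the slope alone, `b ≡ m` and `c ≡ m²`.
  set b := P * (P * τ * (d2 + r * d3) * L3⁻¹) + μ with hb
  have hbv : TakesValue A b m := by
    have h1 : P * τ * (d2 + r * d3) * L3⁻¹ ∈ A :=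
      mul_mem (mul_mem (mul_mem hPv.mem hτ) (add_mem hd2 (mul_mem hrA hd3))) hL3A
    simpa using (hPv.zero_mul h1).add hμv
  refine ⟨b, P * (τ * (d1 + r ^ 2 * d3) * L3⁻¹) + μ * b, m, hm0, hbv, ?_, hBeq, ?_⟩
  · have h1 : τ * (d1 + r ^ 2 * d3) * L3⁻¹ ∈ A :=
      mul_mem (mul_mem hτ (add_mem hd1 (mul_mem (pow_mem hrA 2) hd3))) hL3A
    have h3 := (hPv.zero_mul h1).add (hμv.mul hbv)
    rwa [zero_add, ← sq] at h3
  · rw [quadC, hBeq, ← map_pow _ a 8, ← he, ← hl, hlμ, e1, ← hL3def]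
    field_simp
    linear_combination (L3 * r ^ 2 + L3 * P * b * r) * h2

end ExceptionalStep
-- Two extensions at every quadratic step.
section TwoExtensions

variable {K E L : Type*} [Field K] [Field E] [Field L] [Algebra K E] [Algebra K L] [Algebra E L]
  [IsScalarTower K E L] [CharP K 2] [CharP E 2] [CharP L 2] {a : K}

/-- A place with values in `SplitState` has two extensions, again with values in `SplitState`, to
the quadratic extension generated by a root of `quadFactor`; they are separated by a linear function
of the generator. -/
theorem exists_two_extensions (ha : a ^ 5 + a ^ 2 + 1 = 0) (hex : ∃ w : K, w ^ 2 + w + 1 = 0)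
    {A : ValuationSubring E} {x y : E} {z : L} (hxy : (Phi (algebraMap K E a) x).IsRoot y)
    (hz : z ^ 2 + algebraMap E L (quadB (algebraMap K E a) x y) * z +
      algebraMap E L (quadC (algebraMap K E a) x y) = 0)
    (hzE : z ∉ (algebraMap E L).range) (hx0 : x ≠ algebraMap K E (a ^ 27)) {c d : K}
    (hst : SplitState a c d) (hx : TakesValue A x c) (hy : TakesValue A y d) :
    ∃ (p q : E) (m₁ m₂ d₁ d₂ : K) (V₁ V₂ : ValuationSubring L), m₁ ≠ m₂ ∧
      (V₁.comap (algebraMap E L) = A ∧ SplitState (a ^ 8) d d₁ ∧ TakesValue V₁ z d₁ ∧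
        TakesValue V₁ (algebraMap E L p * z + algebraMap E L q) m₁) ∧
      (V₂.comap (algebraMap E L) = A ∧ SplitState (a ^ 8) d d₂ ∧ TakesValue V₂ z d₂ ∧
        TakesValue V₂ (algebraMap E L p * z + algebraMap E L q) m₂) := by
  rcases hst.step ha hex with ⟨rfl, rfl⟩ | ⟨r, s, t, hstep, hne, hs, ht⟩
  · obtain ⟨b, c, m, hm0, hb, hc, hB, hC⟩ := exists_quadratic_substitution ha hxy hx hy hx0
    obtain ⟨w, hw⟩ := hex
    have h2 : (2 : L) = 0 := CharTwo.two_eq_zero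
    have hP0 : x + algebraMap K E (a ^ 27) ≠ 0 := by
      rw [Ne, CharTwo.add_eq_zero]; exact hx0
    set P := x + algebraMap K E (a ^ 27) with hP
    have hP0' : algebraMap E L P ≠ 0 := by simpa using hP0
    set r := algebraMap K E (a ^ 23) with hr
    set v : L := algebraMap E L P⁻¹ * z + algebraMap E L (P⁻¹ * r) with hv
    have hzv : z = algebraMap E L P * v + algebraMap E L r := by
      rw [hv, map_mul, map_inv₀]
      field_simp
      linear_combination (-(algebraMap E L r)) * h2
    have hveq : v ^ 2 + algebraMap E L b * v + algebraMap E L c = 0 := by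
      have hC' := congrArg (algebraMap E L) hC
      rw [hB] at hC' hz
      simp only [map_add, map_mul, map_pow] at hC' hz
      have h3 : algebraMap E L P ^ 2 * (v ^ 2 + algebraMap E L b * v + algebraMap E L c) = 0 := by
        rw [hzv] at hz
        linear_combination hz - hC' -
          (algebraMap E L P * v * algebraMap E L r) * h2
      exact (mul_eq_zero.1 h3).resolve_left (pow_ne_zero 2 hP0')
    have hvE : v ∉ (algebraMap E L).range := by
      rintro ⟨v', hv'⟩
      exact hzE ⟨P * v' + r, by rw [map_add, map_mul, hv', ← hzv]⟩
    -- The roots of `T² + m T + m²` are `m w` and `m (w + 1)`. Both resulting places give `z` the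
    -- value `(a⁸)³⁰`, so only `v = P⁻¹ (z + r)` tells them apart; hence the separating linear
    -- function in the conclusion.
    have key : ∀ w : K, w ^ 2 + w + 1 = 0 → ∃ V : ValuationSubring L,
        V.comap (algebraMap E L) = A ∧ SplitState (a ^ 8) (a ^ 22) ((a ^ 8) ^ 30) ∧
        TakesValue V z ((a ^ 8) ^ 30) ∧
        TakesValue V (algebraMap E L P⁻¹ * z + algebraMap E L (P⁻¹ * r)) (m * w) := by
      intro w hw
      have h2K : (2 : K) = 0 := CharTwo.two_eq_zero
      have e1 : m = m * w + m * (w + 1) := by linear_combination -(m * w) * h2K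
      have e2 : m ^ 2 = m * w * (m * (w + 1)) := by
        linear_combination -(m ^ 2) * hw + m ^ 2 * h2K
      rw [e1] at hb
      rw [e2] at hc
      obtain ⟨V, hVA, hVv⟩ := exists_extension_quadratic hveq hvE hb hc
      refine ⟨V, hVA, ?_, ?_, hVv⟩
      · rw [pow_eq_twist_pow ha (m := 22) (n := 26) (by norm_num)]
        exact .twentysix_thirty
      · rw [← pow_eq_twist_pow ha (m := 23) (n := 30) (by norm_num)]
        have hPV : TakesValue V (algebraMap E L P) (0 : K) := by
          rw [TakesValue.zero_iff hVv.const_mem]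
          refine valuation_algebraMap_lt_one hVA ?_
          rw [← TakesValue.zero_iff hx.const_mem, ← CharTwo.add_self_eq_zero (a ^ 27)]
          exact hx.add (TakesValue.const hx.const_mem _)
        have := (hPV.mul hVv).add (TakesValue.const hVv.const_mem (a ^ 23))
        rw [zero_mul, zero_add, IsScalarTower.algebraMap_apply K E L, ← hr, ← hzv] at this
        exact this
    obtain ⟨V₁, h1⟩ := key w hw
    obtain ⟨V₂, h2⟩ := key (w + 1) (conj_eq hw)
    refine ⟨P⁻¹, P⁻¹ * r, m * w, m * (w + 1), _, _, V₁, V₂, ?_, h1, h2⟩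
    intro h
    have := mul_left_cancel₀ hm0 h
    simp at this
  · have hB := hx.quadB hy hstep.ne_zero hstep.splits.ne_zero
    have hC := hx.quadC hy hstep.ne_zero hstep.splits.ne_zero
    rw [hstep.quadB_eq] at hB
    rw [hstep.quadC_eq] at hC
    obtain ⟨V₁, hV₁, hz₁⟩ := exists_extension_quadratic hz hzE hB hC
    rw [add_comm] at hB
    rw [mul_comm] at hC
    obtain ⟨V₂, hV₂, hz₂⟩ := exists_extension_quadratic hz hzE hB hC
    refine ⟨1, 0, s, t, s, t, V₁, V₂, hne, ⟨hV₁, hs, hz₁, ?_⟩, ⟨hV₂, ht, hz₂, ?_⟩⟩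
    · simpa using hz₁
    · simpa using hz₂

end TwoExtensions

/-! ### Counting places in the tower. -/

section CompleteSplitting

variable {K Ω : Type*} [Field K] [Field Ω] [Algebra K Ω]

theorem isPlace_of_comap {E E' : IntermediateField K Ω} {h : E ≤ E'} {P : ValuationSubring E}
    (hP : IsPlace K P) {Q : ValuationSubring E'}
    (hQ : Q.comap (IntermediateField.inclusion h : E →+* E') = P) : IsPlace K Q := by
  refine ⟨fun c => ?_, ?_⟩
  · have := hP.1 c
    rw [← hQ, ValuationSubring.mem_comap] at this
    simpa using this
  · rintro rfl
    refine hP.2 ?_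
    rw [← hQ]
    ext x
    simp [ValuationSubring.mem_comap]

theorem finrank_inclusion {E E' : IntermediateField K Ω} (h : E ≤ E') :
    letI : Algebra E E' := (IntermediateField.inclusion h : E →+* E').toAlgebra
    Module.finrank E E' = IntermediateField.relfinrank E E' := by
  let _ : Algebra E E' := (IntermediateField.inclusion h : E →+* E').toAlgebra
  let f : E' ≃ₗ[E] IntermediateField.extendScalars h :=
    { toFun := fun x => ⟨x.1, x.2⟩
      invFun := fun x => ⟨x.1, x.2⟩
      map_add' := fun _ _ => rfl
      map_smul' := fun _ _ => rfl
      left_inv := fun _ => rfl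
      right_inv := fun _ => rfl }
  rw [IntermediateField.relfinrank_eq_finrank_of_le h]
  exact f.finrank_eq

/-- A place splits completely as soon as one exhibits as many places above it as the degree; these
are rational if the place is. -/
theorem splitsCompletely_of_finset {E E' : IntermediateField K Ω} (h : E ≤ E')
    (hfin : IntermediateField.relfinrank E E' ≠ 0) {P : ValuationSubring E} (hP : IsPlace K P)
    (s : Finset (ValuationSubring E'))
    (hs : ∀ Q ∈ s, Q.comap (IntermediateField.inclusion h : E →+* E') = P)
    (hcard : s.card = IntermediateField.relfinrank E E') :
    SplitsCompletely h P ∧ (IsRationalPlace K P → ∀ Q ∈ s, IsRationalPlace K Q) := by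
  let _ : Algebra E E' := (IntermediateField.inclusion h : E →+* E').toAlgebra
  have _ : IsScalarTower K E E' := IsScalarTower.of_algebraMap_eq fun _ => rfl
  have hrank : Module.finrank E E' = IntermediateField.relfinrank E E' := finrank_inclusion h
  have _ : FiniteDimensional E E' :=
    Module.finite_of_finrank_pos (Nat.pos_of_ne_zero (by rwa [hrank]))
  refine ⟨le_antisymm ?_ ?_, fun hrat Q hQ =>
    isRationalPlace_of_card_eq hrat s hs (hcard.trans hrank.symm) hQ⟩
  · by_contra hlt
    -- The set of places is not yet known to be finite; a subset of size one more than the degree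
    -- suffices for the contradiction.
    obtain ⟨t, ht, htc⟩ := Set.exists_subset_encard_eq (Order.add_one_le_of_lt (not_le.1 hlt))
    have htfin : t.Finite := by
      rw [← Set.encard_lt_top_iff, htc]
      exact_mod_cast ENat.natCast_lt_top (IntermediateField.relfinrank E E' + 1)
    have h1 := card_places_le_finrank (A := P) htfin.toFinset fun Q hQ =>
      (ht (htfin.mem_toFinset.1 hQ)).2
    rw [htfin.encard_eq_coe_toFinset_card] at htc
    have h2 : htfin.toFinset.card = IntermediateField.relfinrank E E' + 1 := by exact_mod_cast htc
    omega
  · rw [← hcard, ← Set.encard_coe_eq_coe_finsetCard]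
    exact Set.encard_le_encard fun Q hQ => ⟨isPlace_of_comap hP (hs Q hQ), hs Q hQ⟩

variable {u : ℕ → Ω} {α : K}

/-- A place of `Fₙ₊₁` at which `uₙ` and `uₙ₊₁` take values in `SplitState`. -/
def IsSplitPlace (α : K) (u : ℕ → Ω) (n : ℕ) (Q : ValuationSubring (towerField K u (n + 1))) :
    Prop :=
  ∃ x y, SplitState (α ^ 8 ^ n) x y ∧ TakesValue Q (towerGen K u (Nat.le_succ n)) x ∧
    TakesValue Q (towerGen K u (le_refl (n + 1))) y

theorem comap_inclusion_comap_val {E E' : IntermediateField K Ω} (h : E ≤ E')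
    (V : ValuationSubring Ω) :
    (V.comap (algebraMap E' Ω)).comap (IntermediateField.inclusion h : E →+* E') =
      V.comap (algebraMap E Ω) := rfl

theorem comap_inclusion_self {E : IntermediateField K Ω} (h : E ≤ E) (Q : ValuationSubring E) :
    Q.comap (IntermediateField.inclusion h : E →+* E) = Q := by
  ext x
  exact Iff.rfl

theorem comap_inclusion_comap_inclusion {E E' E'' : IntermediateField K Ω} (h : E ≤ E')
    (h' : E' ≤ E'') (Q : ValuationSubring E'') :
    (Q.comap (IntermediateField.inclusion h' : E' →+* E'')).comap
      (IntermediateField.inclusion h : E →+* E') =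
    Q.comap (IntermediateField.inclusion (h.trans h') : E →+* E'') := by
  ext x
  exact Iff.rfl

theorem takesValue_comap_val {E : IntermediateField K Ω} {V : ValuationSubring Ω} {x : E} {c : K} :
    TakesValue (V.comap (algebraMap E Ω)) x c ↔ TakesValue V (x : Ω) c :=
  takesValue_comap (f := E.val)

variable [CharP K 2]

theorem charP_intermediateField (E : IntermediateField K Ω) : CharP E 2 :=
  charP_of_injective_algebraMap (algebraMap K E).injective 2

variable [CharP Ω 2]

theorem IsTowerSeq.Phi_root_towerGen (hα : α ^ 5 + α ^ 2 + 1 = 0) (hu : IsTowerSeq α u)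
    {i n : ℕ} (h : i + 1 ≤ n) :
    (Phi (algebraMap K (towerField K u n) (α ^ 8 ^ i))
      (towerGen K u ((Nat.le_succ i).trans h))).IsRoot (towerGen K u h) := by
  have h1 := hu.Phi_root hα i
  rw [IsRoot.def, eval_Phi] at h1 ⊢
  apply (algebraMap (towerField K u n) Ω).injective
  simp only [map_add, map_mul, map_pow (algebraMap (towerField K u n) Ω), map_phi₀, map_phi₁,
    map_phi₂, map_phi₃, map_zero, ← IsScalarTower.algebraMap_apply]
  exact h1

/-- At the totally ramified place no state has first value `a²⁷`. This makes the substitution by `x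
- a²⁷` in the exceptional step invertible. -/
theorem IsTowerSeq.ne_const (hα : α ^ 5 + α ^ 2 + 1 = 0) (hu : IsTowerSeq α u) (n : ℕ) :
    u n ≠ algebraMap K Ω ((α ^ 8 ^ n) ^ 27) := by
  obtain ⟨V, c, -, h⟩ := hu.exists_cuspData hα
  obtain ⟨x, y, r, h, -⟩ := h n
  intro h0
  have h1 := h.left
  rw [h0] at h1
  have h2 := (TakesValue.const h1.const_mem _).unique h1
  have ha := twist_pow_eq hα n
  have hst := h.state
  generalize α ^ 8 ^ n = a at ha h2 hst
  cases hst <;> grind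

/-- The extensions are built on `Ω` and restricted to `Fₙ₊₂`. They stay distinct after restriction
because the separating function `p z + q` lies in `Fₙ₊₂`. -/
theorem IsSplitPlace.exists_two (hα : α ^ 5 + α ^ 2 + 1 = 0) (hex : ∃ w : K, w ^ 2 + w + 1 = 0)
    (hu : IsTowerSeq α u) {n : ℕ} {Q : ValuationSubring (towerField K u (n + 1))}
    (hQ : IsSplitPlace α u n Q) :
    ∃ Q₁ Q₂ : ValuationSubring (towerField K u (n + 2)), Q₁ ≠ Q₂ ∧
      (IsSplitPlace α u (n + 1) Q₁ ∧ Q₁.comap (IntermediateField.inclusion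
        (towerField_mono K u (Nat.le_succ (n + 1))) : towerField K u (n + 1) →+* towerField K u (n + 2)) = Q) ∧
      (IsSplitPlace α u (n + 1) Q₂ ∧ Q₂.comap (IntermediateField.inclusion
        (towerField_mono K u (Nat.le_succ (n + 1))) : towerField K u (n + 1) →+* towerField K u (n + 2)) = Q) := by
  have _ := charP_intermediateField (towerField K u (n + 1))
  obtain ⟨x, y, hst, hx, hy⟩ := hQ
  have hx0 : towerGen K u (Nat.le_succ n) ≠
      algebraMap K (towerField K u (n + 1)) ((α ^ 8 ^ n) ^ 27) := fun h =>
    hu.ne_const hα n (congrArg (algebraMap (towerField K u (n + 1)) Ω) h)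
  obtain ⟨p, q, m₁, m₂, d₁, d₂, V₁, V₂, hm, ⟨hV₁, hd₁, hz₁, hm₁⟩, ⟨hV₂, hd₂, hz₂, hm₂⟩⟩ :=
    exists_two_extensions (twist_pow_eq hα n) hex
      (hu.Phi_root_towerGen hα (le_refl (n + 1))) (hu.aeval_quad hα n) (hu.degrees hα n).2 hx0
      hst hx hy
  have e : (α ^ 8 ^ n) ^ 8 = α ^ 8 ^ (n + 1) := by rw [← pow_mul, ← pow_succ]
  rw [e] at hd₁ hd₂
  have key : ∀ (V : ValuationSubring Ω) (d : K),
      V.comap (algebraMap (towerField K u (n + 1)) Ω) = Q → SplitState (α ^ 8 ^ (n + 1)) y d →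
      TakesValue V (u (n + 2)) d →
      IsSplitPlace α u (n + 1) (V.comap (algebraMap (towerField K u (n + 2)) Ω)) := by
    intro V d hVQ hd hz
    refine ⟨y, d, hd, takesValue_comap_val.2 ?_, takesValue_comap_val.2 hz⟩
    rw [← hVQ] at hy
    have hy' := takesValue_comap_val.1 hy
    exact hy'
  refine ⟨V₁.comap (algebraMap (towerField K u (n + 2)) Ω),
    V₂.comap (algebraMap (towerField K u (n + 2)) Ω), ?_, 
    ⟨key V₁ d₁ hV₁ hd₁ hz₁, (comap_inclusion_comap_val _ V₁).trans hV₁⟩,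
    ⟨key V₂ d₂ hV₂ hd₂ hz₂, (comap_inclusion_comap_val _ V₂).trans hV₂⟩⟩
  intro heq
  let v : towerField K u (n + 2) :=
    IntermediateField.inclusion (towerField_mono K u (Nat.le_succ (n + 1))) p *
      towerGen K u (le_refl (n + 2)) +
    IntermediateField.inclusion (towerField_mono K u (Nat.le_succ (n + 1))) q
  have h1 : TakesValue (V₁.comap (algebraMap (towerField K u (n + 2)) Ω)) v m₁ :=
    takesValue_comap_val.2 hm₁
  have h2 : TakesValue (V₂.comap (algebraMap (towerField K u (n + 2)) Ω)) v m₂ :=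
    takesValue_comap_val.2 hm₂
  rw [heq] at h1
  exact hm (h1.unique h2)

/-- Above a finite set of split places of `F₁` there are `2ⁿ` times as many places of `Fₙ₊₁`. -/
theorem exists_finset_above (hα : α ^ 5 + α ^ 2 + 1 = 0) (hex : ∃ w : K, w ^ 2 + w + 1 = 0)
    (hu : IsTowerSeq α u) (s : Finset (ValuationSubring (towerField K u 1)))
    (hs : ∀ Q ∈ s, IsSplitPlace α u 0 Q) (n : ℕ) :
    ∃ t : Finset (ValuationSubring (towerField K u (n + 1))), t.card = s.card * 2 ^ n ∧
      ∀ Q ∈ t, IsSplitPlace α u n Q ∧ Q.comap (IntermediateField.inclusion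
        (towerField_mono K u (Nat.le_add_left 1 n)) : towerField K u 1 →+* towerField K u (n + 1)) ∈ s := by
  classical
  induction n with
  | zero => exact ⟨s, by simp, fun Q hQ => ⟨hs Q hQ, by rwa [comap_inclusion_self]⟩⟩
  | succ n ih =>
    obtain ⟨t, hcard, ht⟩ := ih
    have H : ∀ Q : t, ∃ Q₁ Q₂ : ValuationSubring (towerField K u (n + 2)), Q₁ ≠ Q₂ ∧
      (IsSplitPlace α u (n + 1) Q₁ ∧ Q₁.comap (IntermediateField.inclusion
        (towerField_mono K u (Nat.le_succ (n + 1))) : towerField K u (n + 1) →+* towerField K u (n + 2)) = Q) ∧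
      (IsSplitPlace α u (n + 1) Q₂ ∧ Q₂.comap (IntermediateField.inclusion
        (towerField_mono K u (Nat.le_succ (n + 1))) : towerField K u (n + 1) →+* towerField K u (n + 2)) = Q) :=
      fun Q => (ht Q Q.2).1.exists_two hα hex hu
    choose f g hne hf hg using H
    have hfi : Function.Injective f := fun Q R h => Subtype.ext (by rw [← (hf Q).2, h, (hf R).2])
    have hgi : Function.Injective g := fun Q R h => Subtype.ext (by rw [← (hg Q).2, h, (hg R).2])
    have hdisj : Disjoint (Finset.univ.image f) (Finset.univ.image g) := by
      rw [Finset.disjoint_left]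
      rintro W hW hW'
      obtain ⟨Q, -, hQ⟩ := Finset.mem_image.1 hW
      obtain ⟨R, -, hR⟩ := Finset.mem_image.1 hW'
      have hQR : Q = R := Subtype.ext (by rw [← (hf Q).2, hQ, ← hR, (hg R).2])
      subst hQR
      exact hne Q (hQ.trans hR.symm)
    refine ⟨Finset.univ.image f ∪ Finset.univ.image g, ?_, ?_⟩
    · rw [Finset.card_union_of_disjoint hdisj, Finset.card_image_of_injective _ hfi,
        Finset.card_image_of_injective _ hgi, Finset.card_univ, Fintype.card_coe, hcard]
      ring
    · intro W hW
      rcases Finset.mem_union.1 hW with hW | hW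
      · obtain ⟨Q, -, rfl⟩ := Finset.mem_image.1 hW
        refine ⟨(hf Q).1, ?_⟩
        have := (ht Q Q.2).2
        rwa [← (hf Q).2, comap_inclusion_comap_inclusion] at this
      · obtain ⟨Q, -, rfl⟩ := Finset.mem_image.1 hW
        refine ⟨(hg Q).1, ?_⟩
        have := (ht Q Q.2).2
        rwa [← (hg Q).2, comap_inclusion_comap_inclusion] at this

end CompleteSplitting

/-! ### The four values of `u₀` with three distinct values of `u₁` above them. -/

section SplitValues

variable {K : Type*} [Field K]

/-- A value of `u₀` over which `u₁` takes three distinct values. -/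
def IsSplitValue (a c : K) : Prop :=
  ∃ r s t, PhiSplits a c r s t ∧ r ≠ s ∧ r ≠ t ∧ s ≠ t ∧
    SplitState a c r ∧ SplitState a c s ∧ SplitState a c t

variable [CharP K 2] {a w : K}

theorem pVal_ne_pVal_conj (ha : a ^ 5 + a ^ 2 + 1 = 0) : pVal a w ≠ pVal a (w + 1) := by
  simp only [pVal]
  grind

theorem isSplitValue_five (ha : a ^ 5 + a ^ 2 + 1 = 0) (hw : w ^ 2 + w + 1 = 0) :
    IsSplitValue a (a ^ 5) := by
  refine ⟨_, _, _, phiSplits_five ha hw, ?_, ?_, pVal_ne_pVal_conj ha, .five_thirty, .five_p w hw,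
    .five_p (w + 1) (conj_eq hw)⟩ <;> simp only [pVal] <;> grind

theorem isSplitValue_twentyseven (ha : a ^ 5 + a ^ 2 + 1 = 0) : IsSplitValue a (a ^ 27) := by
  refine ⟨_, _, _, phiSplits_twentyseven ha, ?_, ?_, ?_, .twentyseven_nine, .twentyseven_thirty,
    .twentyseven_twentytwo⟩ <;> grind

theorem isSplitValue_qVal (ha : a ^ 5 + a ^ 2 + 1 = 0) (hw : w ^ 2 + w + 1 = 0) :
    IsSplitValue a (qVal a w) := by
  refine ⟨_, _, _, phiSplits_qVal ha hw, ?_, ?_, pVal_ne_pVal_conj ha, .q_nine w hw, .q_p w hw,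
    .q_p_conj w hw⟩ <;> simp only [pVal] <;> grind

theorem card_splitValues [DecidableEq K] (ha : a ^ 5 + a ^ 2 + 1 = 0) (hw : w ^ 2 + w + 1 = 0) :
    ({a ^ 5, a ^ 27, qVal a w, qVal a (w + 1)} : Finset K).card = 4 ∧
      a ^ 26 ∉ ({a ^ 5, a ^ 27, qVal a w, qVal a (w + 1)} : Finset K) := by
  have h1 : a ^ 5 ≠ a ^ 27 := by grind
  have h2 : a ^ 5 ≠ qVal a w := by simp only [qVal]; grind
  have h3 : a ^ 5 ≠ qVal a (w + 1) := by simp only [qVal]; grind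
  have h4 : a ^ 27 ≠ qVal a w := by simp only [qVal]; grind
  have h5 : a ^ 27 ≠ qVal a (w + 1) := by simp only [qVal]; grind
  have h6 : qVal a w ≠ qVal a (w + 1) := by simp only [qVal]; grind
  have g1 : a ^ 26 ≠ a ^ 5 := by grind
  have g2 : a ^ 26 ≠ a ^ 27 := by grind
  have g3 : a ^ 26 ≠ qVal a w := by simp only [qVal]; grind
  have g4 : a ^ 26 ≠ qVal a (w + 1) := by simp only [qVal]; grind
  constructor
  · rw [Finset.card_insert_of_notMem (by simp [h1, h2, h3]),
      Finset.card_insert_of_notMem (by simp [h4, h5]), Finset.card_pair h6]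
  · simp [g1, g2, g3, g4]

end SplitValues

/-! ### Rationality, complete splitting and the count of rational places. -/

section RationalPlaces

variable {K Ω : Type*} [Field K] [Field Ω] [Algebra K Ω] {u : ℕ → Ω} {α : K}

theorem transcendental_towerGen (hu : IsTowerSeq α u) (n : ℕ) :
    Transcendental K (towerGen K u (Nat.zero_le n)) := fun h =>
  hu.transcendental (h.algHom (towerField K u n).val)

theorem mem_adjoin_of_coe_mem_adjoin {E : IntermediateField K Ω} {t x : E}
    (h : (x : Ω) ∈ IntermediateField.adjoin K {(t : Ω)}) : x ∈ IntermediateField.adjoin K {t} := by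
  have h1 : (IntermediateField.adjoin K {t}).map E.val = IntermediateField.adjoin K {(t : Ω)} := by
    rw [IntermediateField.adjoin_map, Set.image_singleton, IntermediateField.coe_val]
  rw [← h1, IntermediateField.mem_map] at h
  obtain ⟨y, hy, hyx⟩ := h
  rw [IntermediateField.coe_val] at hyx
  rwa [← Subtype.ext hyx]

theorem coe_towerGen {i n : ℕ} (h : i ≤ n) : (towerGen K u h : Ω) = u i := rfl

theorem inclusion_mem_adjoin_towerGen (n : ℕ) (x : towerField K u 0) :
    IntermediateField.inclusion (towerField_mono K u (Nat.zero_le n)) x ∈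
      IntermediateField.adjoin K {towerGen K u (Nat.zero_le n)} := by
  refine mem_adjoin_of_coe_mem_adjoin ?_
  rw [IntermediateField.coe_inclusion, coe_towerGen]
  exact (towerField_zero (K := K) (u := u)).le x.property

theorem isPlace_of_takesValue (hu : IsTowerSeq α u) {n : ℕ} {c : K}
    {P : ValuationSubring (towerField K u n)}
    (hP : TakesValue P (towerGen K u (Nat.zero_le n)) c) : IsPlace K P :=
  hP.isPlace fun h => transcendental_towerGen hu n (h ▸ isAlgebraic_algebraMap c)

theorem isRationalPlace_zero (hu : IsTowerSeq α u) {c : K}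
    {P : ValuationSubring (towerField K u 0)}
    (hP : TakesValue P (towerGen K u (Nat.zero_le 0)) c) : IsRationalPlace K P := by
  refine ⟨isPlace_of_takesValue hu hP, fun x hx => ?_⟩
  obtain ⟨d, hd⟩ := exists_takesValue_of_mem_adjoin hP (transcendental_towerGen hu 0)
    (inclusion_mem_adjoin_towerGen 0 x) hx
  exact ⟨d, hd.lt_one⟩

variable [CharP K 2] [CharP Ω 2]

/-- The ramification index three equals `[F₁ : F₀]`, witnessed by `u₁ - α³⁰`, so the residue field
is that of the place below, namely `K`. -/
theorem isRationalPlace_one (hα : α ^ 5 + α ^ 2 + 1 = 0) (hu : IsTowerSeq α u)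
    {P : ValuationSubring (towerField K u 1)}
    (hP : TakesValue P (towerGen K u (Nat.zero_le 1)) (α ^ 26)) : IsRationalPlace K P := by
  have _ := charP_intermediateField (towerField K u 1)
  refine ⟨isPlace_of_takesValue hu hP, fun x hx => ?_⟩
  have hroot := hu.Phi_root_towerGen hα (le_refl 1)
  rw [pow_zero, pow_one] at hroot
  obtain ⟨-, hπ⟩ := takesValue_and_valuation_twentysix hα hroot hP
  let _ : Algebra (towerField K u 0) (towerField K u 1) :=
    (IntermediateField.inclusion (towerField_mono K u (Nat.zero_le 1)) :
      towerField K u 0 →+* towerField K u 1).toAlgebra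
  have ht := transcendental_towerGen hu 1
  have hγ : P.valuation (towerGen K u (Nat.zero_le 1) - algebraMap K _ (α ^ 26)) ≠ 0 := by
    rw [Ne, map_eq_zero, sub_eq_zero]
    exact fun h => ht (h ▸ isAlgebraic_algebraMap _)
  have hrank : 3 = Module.finrank (towerField K u 0) (towerField K u 1) := by
    rw [finrank_inclusion (towerField_mono K u (Nat.zero_le 1)), (hu.minpoly_one hα).2.1]
  obtain ⟨d, hd⟩ := exists_takesValue_of_totally_ramified (E := towerField K u 0) hP.const_mem
    (fun y hy => exists_valuation_eq_zpow hP ht (inclusion_mem_adjoin_towerGen 1 y)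
      ((_root_.map_ne_zero _).2 hy)) hγ hP.lt_one hπ hrank (by norm_num)
    (fun y hy => exists_takesValue_of_mem_adjoin hP ht (inclusion_mem_adjoin_towerGen 1 y) hy) hx
  exact ⟨d, hd.lt_one⟩

theorem IsTowerSeq.relfinrank_one (hα : α ^ 5 + α ^ 2 + 1 = 0) (hu : IsTowerSeq α u) (n : ℕ) :
    IntermediateField.relfinrank (towerField K u 1) (towerField K u (n + 1)) = 2 ^ n := by
  have h := IntermediateField.relfinrank_mul_relfinrank (towerField_mono K u (Nat.zero_le 1))
    (towerField_mono K u (Nat.le_add_left 1 n))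
  rw [(hu.minpoly_one hα).2.1, (hu.degrees hα n).1] at h
  omega

/-- The three distinct roots of the reduced cubic give three places of `F₁`, separated by the value
of `u₁`; the doubling above `F₁` does the rest. -/
theorem exists_finset_above_zero (hα : α ^ 5 + α ^ 2 + 1 = 0) (hex : ∃ w : K, w ^ 2 + w + 1 = 0)
    (hu : IsTowerSeq α u) {c : K} (hc : IsSplitValue α c) {P : ValuationSubring (towerField K u 0)}
    (hP : TakesValue P (towerGen K u (Nat.zero_le 0)) c) (n : ℕ) :
    ∃ t : Finset (ValuationSubring (towerField K u (n + 1))), t.card = 3 * 2 ^ n ∧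
      ∀ Q ∈ t, Q.comap (IntermediateField.inclusion
        (towerField_mono K u (Nat.zero_le (n + 1))) :
          towerField K u 0 →+* towerField K u (n + 1)) = P := by
  classical
  obtain ⟨r, s, t, hsp, hrs, hrt, hst, hr, hs, ht⟩ := hc
  obtain ⟨hint, -, hmin⟩ := hu.minpoly_one hα
  have key : ∀ r s t : K, PhiSplits α c r s t → SplitState α c r →
      ∃ Q : ValuationSubring (towerField K u 1), IsSplitPlace α u 0 Q ∧
        TakesValue Q (towerGen K u (le_refl 1)) r ∧ Q.comap (IntermediateField.inclusion
          (towerField_mono K u (Nat.zero_le 1)) : towerField K u 0 →+* towerField K u 1) = P := by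
    intro r s t hsp hr
    obtain ⟨V, hVP, hV⟩ := exists_extension_cubic hint hmin hsp hP
    have h1 : TakesValue (V.comap (algebraMap (towerField K u 1) Ω))
        (towerGen K u (le_refl 1)) r := takesValue_comap_val.2 hV
    refine ⟨V.comap (algebraMap (towerField K u 1) Ω), ⟨c, r, by simpa using hr, ?_, h1⟩, h1,
      (comap_inclusion_comap_val _ V).trans hVP⟩
    rw [← hVP] at hP
    have h0 := takesValue_comap_val.1 hP
    exact takesValue_comap_val.2 h0
  obtain ⟨Q₁, h1, hv1, hQ1⟩ := key r s t hsp hr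
  obtain ⟨Q₂, h2, hv2, hQ2⟩ := key s t r hsp.rotate hs
  obtain ⟨Q₃, h3, hv3, hQ3⟩ := key t r s hsp.rotate.rotate ht
  have h12 : Q₁ ≠ Q₂ := by rintro rfl; exact hrs (hv1.unique hv2)
  have h13 : Q₁ ≠ Q₃ := by rintro rfl; exact hrt (hv1.unique hv3)
  have h23 : Q₂ ≠ Q₃ := by rintro rfl; exact hst (hv2.unique hv3)
  obtain ⟨T, hT, hTs⟩ := exists_finset_above hα hex hu {Q₁, Q₂, Q₃}
    (by simp only [Finset.mem_insert, Finset.mem_singleton]; rintro Q (rfl | rfl | rfl) <;> assumption)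
    n
  refine ⟨T, ?_, fun Q hQ => ?_⟩
  · rw [hT, Finset.card_eq_three.2 ⟨Q₁, Q₂, Q₃, h12, h13, h23, rfl⟩]
  · have h := (hTs Q hQ).2
    rw [← comap_inclusion_comap_inclusion (towerField_mono K u (Nat.zero_le 1))
      (towerField_mono K u (Nat.le_add_left 1 n))]
    simp only [Finset.mem_insert, Finset.mem_singleton] at h
    rcases h with h | h | h <;> rw [h] <;> assumption

theorem splitsCompletely_zero (hα : α ^ 5 + α ^ 2 + 1 = 0) (hex : ∃ w : K, w ^ 2 + w + 1 = 0)
    (hu : IsTowerSeq α u) {c : K} (hc : IsSplitValue α c) {P : ValuationSubring (towerField K u 0)}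
    (hP : TakesValue P (towerGen K u (Nat.zero_le 0)) c) (n : ℕ) :
    SplitsCompletely (towerField_mono K u (Nat.zero_le (n + 1))) P ∧
      ∃ t : Finset (ValuationSubring (towerField K u (n + 1))), t.card = 3 * 2 ^ n ∧
        ∀ Q ∈ t, IsRationalPlace K Q ∧ TakesValue Q (towerGen K u (Nat.zero_le (n + 1))) c := by
  obtain ⟨t, htc, ht⟩ := exists_finset_above_zero hα hex hu hc hP n
  have hdeg := (hu.degrees hα n).1
  obtain ⟨h1, h2⟩ := splitsCompletely_of_finset (towerField_mono K u (Nat.zero_le (n + 1)))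
    (by rw [hdeg]; positivity) (isPlace_of_takesValue hu hP) t ht (htc.trans hdeg.symm)
  refine ⟨h1, t, htc, fun Q hQ => ⟨h2 (isRationalPlace_zero hu hP) Q hQ, ?_⟩⟩
  rw [← ht Q hQ] at hP
  exact takesValue_comap (f := IntermediateField.inclusion _).1 hP

/-- The triple root forces `u₁ = α³⁰`, so any such place starts in the state `twentysix_thirty` and
doubles at each later step. -/
theorem splitsCompletely_one (hα : α ^ 5 + α ^ 2 + 1 = 0) (hex : ∃ w : K, w ^ 2 + w + 1 = 0)
    (hu : IsTowerSeq α u) {P : ValuationSubring (towerField K u 1)}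
    (hP : TakesValue P (towerGen K u (Nat.zero_le 1)) (α ^ 26)) (n : ℕ) :
    SplitsCompletely (towerField_mono K u (Nat.le_add_left 1 n)) P ∧
      ∃ t : Finset (ValuationSubring (towerField K u (n + 1))), t.card = 2 ^ n ∧
        ∀ Q ∈ t, IsRationalPlace K Q ∧
          TakesValue Q (towerGen K u (Nat.zero_le (n + 1))) (α ^ 26) := by
  have _ := charP_intermediateField (towerField K u 1)
  have hroot := hu.Phi_root_towerGen hα (le_refl 1)
  rw [pow_zero, pow_one] at hroot
  have hP1 := (takesValue_and_valuation_twentysix hα hroot hP).1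
  obtain ⟨t, htc, ht⟩ := exists_finset_above hα hex hu {P} (fun Q hQ => by
    rw [Finset.mem_singleton] at hQ
    subst hQ
    exact ⟨α ^ 26, α ^ 30, by simpa using SplitState.twentysix_thirty, hP, hP1⟩) n
  rw [Finset.card_singleton, one_mul] at htc
  have hdeg := hu.relfinrank_one hα n
  obtain ⟨h1, h2⟩ := splitsCompletely_of_finset (towerField_mono K u (Nat.le_add_left 1 n))
    (by rw [hdeg]; positivity) (isPlace_of_takesValue hu hP) t
    (fun Q hQ => Finset.mem_singleton.1 (ht Q hQ).2) (htc.trans hdeg.symm)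
  refine ⟨h1, t, htc, fun Q hQ => ⟨h2 (isRationalPlace_one hα hu hP) Q hQ, ?_⟩⟩
  rw [← Finset.mem_singleton.1 (ht Q hQ).2] at hP
  exact takesValue_comap (f := IntermediateField.inclusion _).1 hP

/-- Five values of `u₀` contribute `4 · 3 · 2ⁿ + 2ⁿ` places; families for different values are
disjoint because a function has at most one value at a place. -/
theorem le_encard_rationalPlaces (hα : α ^ 5 + α ^ 2 + 1 = 0) (hex : ∃ w : K, w ^ 2 + w + 1 = 0)
    (hu : IsTowerSeq α u) (n : ℕ) :
    ((13 * 2 ^ n : ℕ) : ℕ∞) ≤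
      {Q : ValuationSubring (towerField K u (n + 1)) | IsRationalPlace K Q}.encard := by
  classical
  have hex' := hex
  obtain ⟨w, hw⟩ := hex'
  obtain ⟨hS, hS'⟩ := card_splitValues hα hw
  set S : Finset K := {α ^ 5, α ^ 27, qVal α w, qVal α (w + 1)} with hSdef
  have H : ∀ c ∈ S, IsSplitValue α c := by
    simp only [hSdef, Finset.mem_insert, Finset.mem_singleton]
    rintro c (rfl | rfl | rfl | rfl)
    exacts [isSplitValue_five hα hw, isSplitValue_twentyseven hα, isSplitValue_qVal hα hw,
      isSplitValue_qVal hα (conj_eq hw)]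
  have hT : ∀ c : S, ∃ t : Finset (ValuationSubring (towerField K u (n + 1))),
      t.card = 3 * 2 ^ n ∧ ∀ Q ∈ t, IsRationalPlace K Q ∧
        TakesValue Q (towerGen K u (Nat.zero_le (n + 1))) (c : K) := by
    intro c
    obtain ⟨V, hV⟩ := exists_takesValue_of_transcendental hu.transcendental (c : K)
    have hP : TakesValue (V.comap (algebraMap (towerField K u 0) Ω))
      (towerGen K u (Nat.zero_le 0)) (c : K) := takesValue_comap_val.2 hV
    exact (splitsCompletely_zero hα hex hu (H c c.2) hP n).2
  choose T hTc hT using hT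
  obtain ⟨V, hV⟩ := exists_takesValue_of_transcendental hu.transcendental (α ^ 26)
  have hP : TakesValue (V.comap (algebraMap (towerField K u 1) Ω))
      (towerGen K u (Nat.zero_le 1)) (α ^ 26) := takesValue_comap_val.2 hV
  obtain ⟨T', hTc', hT'⟩ := (splitsCompletely_one hα hex hu hP n).2
  have hdisj : ∀ c ∈ (Finset.univ : Finset S), ∀ d ∈ (Finset.univ : Finset S), c ≠ d →
      Disjoint (T c) (T d) := by
    intro c _ d _ hcd
    rw [Finset.disjoint_left]
    exact fun Q hQ hQ' => hcd (Subtype.ext ((hT c Q hQ).2.unique (hT d Q hQ').2))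
  have hdisj' : Disjoint (Finset.univ.biUnion T) T' := by
    rw [Finset.disjoint_left]
    intro Q hQ hQ'
    obtain ⟨c, -, hc⟩ := Finset.mem_biUnion.1 hQ
    exact hS' ((hT c Q hc).2.unique (hT' Q hQ').2 ▸ c.2)
  have hcard : (Finset.univ.biUnion T ∪ T').card = 13 * 2 ^ n := by
    rw [Finset.card_union_of_disjoint hdisj', Finset.card_biUnion hdisj,
      Finset.sum_congr rfl fun c _ => hTc c, Finset.sum_const, Finset.card_univ, Fintype.card_coe,
      hS, hTc', smul_eq_mul]
    ring
  rw [← hcard, ← Set.encard_coe_eq_coe_finsetCard]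
  refine Set.encard_le_encard fun Q hQ => ?_
  rcases Finset.mem_union.1 (Finset.mem_coe.1 hQ) with hQ | hQ
  · obtain ⟨c, -, hc⟩ := Finset.mem_biUnion.1 hQ
    exact (hT c Q hc).1
  · exact (hT' Q hQ).1

end RationalPlaces

/-! ### Constants expressed through the primitive element, and the theorem. -/

theorem charP_two_of_card {K : Type*} [Field K] (hK : Nat.card K = 2 ^ 10) : CharP K 2 := by
  have _ : Finite K := Nat.finite_of_card_ne_zero (by rw [hK]; norm_num)
  have _ := Fintype.ofFinite K
  have h : ((Fintype.card K : ℕ) : K) = 0 := Nat.cast_card_eq_zero K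
  rw [← Nat.card_eq_fintype_card, hK, Nat.cast_pow] at h
  refine CharTwo.of_one_ne_zero_of_two_eq_zero one_ne_zero ?_
  exact_mod_cast pow_eq_zero_iff (by norm_num) |>.1 h

/-- Since `1023 = 3 · 341`, `β³⁴¹` is a primitive cube root of unity, the `ω` of the tables. -/
theorem cube_root_eq {K : Type*} [Field K] {β : K} (hβ : IsPrimitiveRoot β (2 ^ 10 - 1)) :
    (β ^ 341) ^ 2 + β ^ 341 + 1 = 0 := by
  have h1 : β ^ 341 ≠ 1 := hβ.pow_ne_one_of_pos_of_lt (by norm_num) (by norm_num)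
  have h3 : (β ^ 341) ^ 3 = 1 := by rw [← pow_mul]; exact hβ.pow_eq_one
  refine (mul_eq_zero.1 ?_).resolve_left (sub_ne_zero.2 h1)
  linear_combination h3

/-- The degree-ten equation for `β` enters only here, to write the values `q(α, ω)` and `q(α, ω +
1)` as powers of `β`. -/
theorem qVal_eq_pow {K : Type*} [Field K] [CharP K 2] {β : K}
    (h : β ^ 10 + β ^ 6 + β ^ 5 + β ^ 3 + β ^ 2 + β + 1 = 0) :
    β ^ 368 = qVal (β ^ 33) (β ^ 341) ∧ β ^ 523 = qVal (β ^ 33) (β ^ 341 + 1) := by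
  constructor <;> simp only [qVal] <;> grind

theorem IsPlaceAt.takesValue {K F : Type*} [Field K] [Field F] [Algebra K F] {x : F} {c : K}
    {A : ValuationSubring F} (h : IsPlaceAt K x c A) : TakesValue A x c :=
  ⟨h.1.1, h.2⟩

end DrinfeldTower

open DrinfeldTower in
theorem mainTheorem7 {K Ω : Type*} [Field K] [Field Ω] [Algebra K Ω]
    (hK : Nat.card K = 2 ^ 10)
    (β : K) (hβ : IsPrimitiveRoot β (2 ^ 10 - 1))
    (hα : (β ^ 33) ^ 5 + (β ^ 33) ^ 2 + 1 = 0)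
    (u : ℕ → Ω) (hu : IsTowerSeq (β ^ 33) u)
    (n : ℕ) (hn : 0 < n) :
    -- the number of rational places
    ((13 * 2 ^ (n - 1) : ℕ) : ℕ∞) ≤
        {Q : ValuationSubring (towerField K u n) | IsRationalPlace K Q}.encard ∧
    -- completely split places of `F₀`
    (∀ c ∈ ({β ^ 165, β ^ 891} : Set K), ∀ P : ValuationSubring (towerField K u 0),
        IsPlaceAt K (towerGen K u le_rfl) c P →
          SplitsCompletely (towerField_mono K u (Nat.zero_le n)) P) ∧
    (β ^ 10 + β ^ 6 + β ^ 5 + β ^ 3 + β ^ 2 + β + 1 = 0 →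
      ∀ c ∈ ({β ^ 368, β ^ 523} : Set K), ∀ P : ValuationSubring (towerField K u 0),
        IsPlaceAt K (towerGen K u le_rfl) c P →
          SplitsCompletely (towerField_mono K u (Nat.zero_le n)) P) ∧
    -- the place of `F₁` above `u₀ = β ^ 858`
    (∀ P : ValuationSubring (towerField K u 1),
        IsPlaceAt K (towerGen K u (Nat.zero_le 1)) (β ^ 858) P →
          SplitsCompletely (towerField_mono K u hn) P) := by
  have _ := charP_two_of_card hK
  have _ : CharP Ω 2 := charP_of_injective_algebraMap (algebraMap K Ω).injective 2
  have hw := cube_root_eq hβ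
  have hex : ∃ w : K, w ^ 2 + w + 1 = 0 := ⟨_, hw⟩
  obtain ⟨m, rfl⟩ : ∃ m, n = m + 1 := ⟨n - 1, by omega⟩
  refine ⟨le_encard_rationalPlaces hα hex hu m, fun c hc P hP => ?_, fun h c hc P hP => ?_,
    fun P hP => ?_⟩
  · have hc' : IsSplitValue (β ^ 33) c := by
      rcases hc with rfl | rfl
      · rw [show 165 = 33 * 5 by norm_num, pow_mul]
        exact isSplitValue_five hα hw
      · rw [show 891 = 33 * 27 by norm_num, pow_mul]
        exact isSplitValue_twentyseven hα
    exact (splitsCompletely_zero hα hex hu hc' hP.takesValue m).1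
  · have hc' : IsSplitValue (β ^ 33) c := by
      rcases hc with rfl | rfl
      · rw [(qVal_eq_pow h).1]
        exact isSplitValue_qVal hα hw
      · rw [(qVal_eq_pow h).2]
        exact isSplitValue_qVal hα (conj_eq hw)
    exact (splitsCompletely_zero hα hex hu hc' hP.takesValue m).1
  · rw [show 858 = 33 * 26 by norm_num, pow_mul] at hP
    exact (splitsCompletely_one hα hex hu hP.takesValue m).1
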